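/- Let $n\ge 0$ and $k\ge 1$ be integers. A parking preference of length $n$ is a sequence $(a_1,\dots,a_n)$ of integers in $\{1,\dots,n\}$. For $j\ge 0$ it is a $j$-Naples parking function if $n$ cars, arriving one after another on a one-way street with initially empty spots $1,\dots,n$, can all park under the following rule: car $i$ tries the spots $a_i, a_i-1,\dots,a_i-j$ in this order (ignoring numbers less than $1$), then the spots $a_i+1,a_i+2,\dots,n$ in this order, and parks in the first of them that is unoccupied. A parking preference is strictly $k$-Naples if it is a $k$-Naples parking function but not a $(k-1)$-Naples parking function, and it is descending if $a_1\ge a_2\ge\dots\ge a_n$. A dissection of a convex polygon cuts it into pieces along pairwise non-crossing diagonals. **Theorem.** The descending strictly $k$-Naples parking functions of length $n$ are in bijection with the pairs consisting of a dissection of a convex $(n+k+1)$-gon into one $(2k+2)$-gon and triangles (of which there are then $n-k-1$) and a distinguished edge of the $(2k+2)$-gon (a diagonal of the dissection or a side of the $(n+k+1)$-gon), where such pairs are considered up to rotation of the $(n+k+1)$-gon. (If $n\le k$, both sets are empty.) -/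

import Mathlib

/-! ### Naples parking functions -/

/-- The spots (numbered from `1` to `n`) that a car with preference `p` tries, in order, under the
`k`-Naples rule: first `p, p - 1, …, p - k` (as long as the number is at least `1`), and then
`p + 1, p + 2, …, n`. -/
def naplesSpots (k n p : ℕ) : List ℕ :=
  ((List.range (k + 1)).map fun j => p - j).filter (fun x => 1 ≤ x) ++
    (List.range (n - p)).map fun j => p + 1 + j

/-- With `occ` the set of occupied spots, the cars with the listed preferences arrive one after
the other, each parks in the first free spot of its list of spots, and none of them fails. -/
def AllPark (k n : ℕ) : Finset ℕ → List ℕ → Prop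
  | _, [] => True
  | occ, p :: ps =>
    ∃ d, (naplesSpots k n p).find? (fun x => x ∉ occ) = some d ∧ AllPark k n (insert d occ) ps

/-- A parking preference of length `n`: a sequence of `n` integers in `{1, …, n}`. -/
def IsParkingPreference {n : ℕ} (a : Fin n → ℕ) : Prop :=
  ∀ i, 1 ≤ a i ∧ a i ≤ n

/-- `a` is a `k`-Naples parking function of length `n`: a parking preference such that all cars
can park under the `k`-Naples rule, starting from an empty street. -/
def IsNaples (k : ℕ) {n : ℕ} (a : Fin n → ℕ) : Prop :=
  IsParkingPreference a ∧ AllPark k n ∅ (List.ofFn a)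

/-- Strictly `k`-Naples (for `k ≥ 1`): `k`-Naples but not `(k - 1)`-Naples. -/
def IsStrictlyNaples (k : ℕ) {n : ℕ} (a : Fin n → ℕ) : Prop :=
  IsNaples k a ∧ ¬ IsNaples (k - 1) a

/-- The descending (weakly decreasing) strictly `k`-Naples parking functions of length `n`. -/
def DescStrictlyNaples (k n : ℕ) : Type :=
  {a : Fin n → ℕ // Antitone a ∧ IsStrictlyNaples k a}

/-! ### Dissections of a convex polygon

The vertices of a convex `m`-gon are labelled by `ZMod m` in cyclic order, with the strict circular
order `sbtw` of `ZMod m`. A segment between two vertices is an element of `Sym2 (ZMod m)`, and a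
polygon inscribed in the `m`-gon is given by the set of its vertices. -/

/-- The sides of the inscribed polygon with vertex set `P`: the segments `ab` between distinct
vertices of `P` that are consecutive, i.e. no vertex of `P` lies strictly between `a` and `b`. -/
def polygonSides {m : ℕ} (P : Set (ZMod m)) : Set (Sym2 (ZMod m)) :=
  {e | ∃ a ∈ P, ∃ b ∈ P, a ≠ b ∧ (∀ c ∈ P, ¬ sbtw a c b) ∧ e = s(a, b)}

/-- The diagonals of the inscribed polygon with vertex set `P`: the segments between distinct
vertices of `P` that are not sides of it. -/
def polygonDiagonals {m : ℕ} (P : Set (ZMod m)) : Set (Sym2 (ZMod m)) :=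
  {e | ∃ a ∈ P, ∃ b ∈ P, a ≠ b ∧ e = s(a, b) ∧ e ∉ polygonSides P}

/-- Two segments cross in their interiors: `e = ab`, `f = cd` with `a, c, b, d` in this
(strict) cyclic order. -/
def SegmentsCross {m : ℕ} (e f : Sym2 (ZMod m)) : Prop :=
  ∃ a b c d, e = s(a, b) ∧ f = s(c, d) ∧ sbtw a c b ∧ sbtw b d a

/-- A set of segments dissects the `m`-gon: it consists of pairwise non-crossing diagonals. -/
def IsDissection {m : ℕ} (D : Set (Sym2 (ZMod m))) : Prop :=
  D ⊆ polygonDiagonals Set.univ ∧ ∀ e ∈ D, ∀ f ∈ D, ¬ SegmentsCross e f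

/-- `P` is the vertex set of one of the pieces into which the set `D` of diagonals cuts the
`m`-gon: each side of `P` is a side of the `m`-gon or belongs to `D`, and no element of `D` cuts
through `P`. -/
def IsPiece {m : ℕ} (D : Set (Sym2 (ZMod m))) (P : Set (ZMod m)) : Prop :=
  3 ≤ P.ncard ∧ polygonSides P ⊆ polygonSides Set.univ ∪ D ∧ Disjoint (polygonDiagonals P) D

/-- An `r`-in-`m` dissection with a distinguished edge: a dissection of the `m`-gon into one
`r`-gon (called `center`) and triangles (of which there are then necessarily `m - r`), together
with one side `edge` of the `r`-gon. For `r ≠ 3` the `r`-gon is determined by the dissection. -/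
structure MarkedDissection (r m : ℕ) where
  diagonals : Set (Sym2 (ZMod m))
  isDissection : IsDissection diagonals
  center : Set (ZMod m)
  isPiece_center : IsPiece diagonals center
  ncard_center : center.ncard = r
  ncard_of_ne : ∀ Q, IsPiece diagonals Q → Q ≠ center → Q.ncard = 3
  edge : Sym2 (ZMod m)
  edge_mem : edge ∈ polygonSides center

/-- `y` is obtained from `x` by the rotation `v ↦ v + c` of the `m`-gon, for some `c`. -/
def MarkedDissection.Rotated {r m : ℕ} (x y : MarkedDissection r m) : Prop :=
  ∃ c : ZMod m,
    y.diagonals = Sym2.map (fun v => v + c) '' x.diagonals ∧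
    y.center = (fun v => v + c) '' x.center ∧
    y.edge = Sym2.map (fun v => v + c) x.edge

/-- Being equal up to rotation is an equivalence relation. -/
instance MarkedDissection.rotationSetoid (r m : ℕ) : Setoid (MarkedDissection r m) where
  r := MarkedDissection.Rotated
  iseqv := by
    refine ⟨fun x => ⟨0, ?_, ?_, ?_⟩, ?_, ?_⟩
    · simp [Sym2.map_id']
    · simp
    · simp [Sym2.map_id']
    · rintro x y ⟨c, h1, h2, h3⟩
      refine ⟨-c, ?_, ?_, ?_⟩
      · simp [h1, Set.image_image, Sym2.map_map, Sym2.map_id']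
      · simp only [h2, Set.image_image, add_neg_cancel_right, Set.image_id']
      · simp [h3, Sym2.map_map, Sym2.map_id']
    · rintro x y z ⟨c, h1, h2, h3⟩ ⟨d, g1, g2, g3⟩
      refine ⟨c + d, ?_, ?_, ?_⟩
      · simp [g1, h1, Set.image_image, Sym2.map_map, add_assoc]
      · simp only [g2, h2, Set.image_image, add_assoc]
      · simp [g3, h3, Sym2.map_map, add_assoc]

/-- The `r`-in-`m` dissections with a distinguished edge on the `r`-gon, up to rotation. -/
def MarkedDissectionUpToRotation (r m : ℕ) : Type :=
  Quotient (MarkedDissection.rotationSetoid r m)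

/-! ### Counting descending Naples parking functions -/

/-! Both sets are finite of size C(2n-1, n+k) - C(2n-1, n+k+1); the final bijection comes from this
equality alone and is not explicit.

For a descending preference, indexed from 0, being `k`-Naples amounts to the staircase bound `a i +
i ≤ n + k` (`isNaples_iff_of_antitone`): cars preferring spots from `q + k` on cannot back up below
`q`, so too many of them do not fit, and conversely the bound leaves a free spot by pigeonhole.
Descending sequences below a staircase satisfy a Pascal-type recursion solved by ballot numbers
(`ncard_boundedAntitone`); the strictly `k`-Naples ones are the difference of the counts for `k` and
`k - 1`.

On the other side, the marked edge removes all rotational symmetry. Let m = n+k+1 and r = 2k+2, and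
cut the m-gon open at the initial vertex of the marked edge, so that its vertices are labelled 0, …,
m with 0 and m the same vertex. Each side of the r-gon then spans an interval of labels, and the
triangulated region beyond it is a binary tree: segments are nodes, sides of the m-gon are leaves,
triangles are inner nodes. So the classes correspond to sequences of r binary trees with m leaves in
total (`nonempty_equiv_markedDissectionUpToRotation`). Deleting the first tree if it is a leaf, and
its root otherwise, gives a recursion (`binaryForests_succ`) whose solution is again a ballot number
(`numForests_add_choose`). -/

theorem mem_naplesSpots {k n p x : ℕ} (hp : p ≤ n) :
    x ∈ naplesSpots k n p ↔ 1 ≤ x ∧ p ≤ x + k ∧ x ≤ n := by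
  simp only [naplesSpots, List.mem_append, List.mem_filter, List.mem_map, List.mem_range,
    decide_eq_true_eq]
  constructor
  · rintro (⟨⟨j, hj, rfl⟩, h⟩ | ⟨j, hj, rfl⟩) <;> omega
  · rintro ⟨h1, h2, h3⟩
    by_cases hx : x ≤ p
    · exact Or.inl ⟨⟨p - x, by omega, by omega⟩, h1⟩
    · exact Or.inr ⟨x - (p + 1), by omega, by omega⟩

/-- Pigeonhole: a car with preference `p` can reach every spot from `max 1 (p - k)` to `n`, and the
bound makes these more numerous than the occupied ones. -/
theorem allPark_of_le {k n : ℕ} : ∀ (l : List ℕ) (occ : Finset ℕ),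
    (∀ j (h : j < l.length), 1 ≤ l[j] ∧ l[j] ≤ n ∧ l[j] + (occ.card + j) ≤ n + k) →
    occ.card + l.length ≤ n → AllPark k n occ l
  | [], _, _, _ => trivial
  | p :: ps, occ, h, hn => by
    obtain ⟨hp1, hpn, hpk⟩ := h 0 (by simp)
    simp only [List.getElem_cons_zero, add_zero, List.length_cons] at hp1 hpn hpk hn
    have hsome : ∃ d, (naplesSpots k n p).find? (fun x => x ∉ occ) = some d := by
      rw [← Option.isSome_iff_exists, ← Option.ne_none_iff_isSome]
      intro hnone
      rw [List.find?_eq_none] at hnone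
      have hsub : Finset.Icc (max 1 (p - k)) n ⊆ occ := by
        intro x hx
        rw [Finset.mem_Icc] at hx
        have := hnone x ((mem_naplesSpots hpn).2 ⟨by omega, by omega, hx.2⟩)
        simpa using this
      have := Finset.card_le_card hsub
      rw [Nat.card_Icc] at this
      omega
    obtain ⟨d, hd⟩ := hsome
    have hdo : d ∉ occ := by simpa using List.find?_some hd
    have hc := Finset.card_insert_of_notMem hdo
    refine ⟨d, hd, allPark_of_le ps _ ?_ (by omega)⟩
    intro j hj
    have := h (j + 1) (by simpa using hj)
    simp only [List.getElem_cons_succ] at this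
    omega

/-- A car backs up by at most `k`, so the cars of `l` never leave `[q, n]`, and they take distinct
spots there. -/
theorem AllPark.card_le {k n q : ℕ} (hq : 1 ≤ q) (l₂ : List ℕ) : ∀ (l : List ℕ) (occ : Finset ℕ),
    AllPark k n occ (l ++ l₂) → (∀ p ∈ l, q + k ≤ p ∧ p ≤ n) → occ ⊆ Finset.Icc q n →
    occ.card + l.length ≤ n + 1 - q
  | [], occ, _, _, ho => by simpa using Finset.card_le_card ho
  | p :: ps, occ, ⟨d, hd, h⟩, hl, ho => by
    have hp := hl p (by simp)
    have hdm := (mem_naplesSpots hp.2).1 (List.mem_of_find?_eq_some hd)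
    have hdo : d ∉ occ := by simpa using List.find?_some hd
    have hc := Finset.card_insert_of_notMem hdo
    have := AllPark.card_le hq l₂ ps _ h (fun p hp => hl p (by simp [hp])) (by
      intro x hx
      rcases Finset.mem_insert.1 hx with rfl | hx
      · rw [Finset.mem_Icc]; omega
      · exact ho hx)
    simp only [List.length_cons]
    omega

theorem isNaples_iff_of_antitone {k n : ℕ} {a : Fin n → ℕ} (ha : Antitone a) :
    IsNaples k a ↔ IsParkingPreference a ∧ ∀ i : Fin n, a i + i ≤ n + k := by
  refine and_congr_right fun hp => ⟨fun h i => ?_, fun h => ?_⟩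
  · by_contra hi
    have hil := i.2
    -- If the bound fails at `i`, the first `i + 1` cars all prefer spots from `q + k` on with `q =
    -- n + 1 - i`, yet `[q, n]` has only `i` spots.
    have key := AllPark.card_le (k := k) (n := n) (q := n + 1 - i) (by omega)
      ((List.ofFn a).drop (i + 1)) ((List.ofFn a).take (i + 1)) ∅ (by simpa using h) ?_ (by simp)
    · simp at key
      omega
    · intro p hpm
      obtain ⟨j, hj, rfl⟩ := List.mem_iff_getElem.1 hpm
      simp only [List.length_take, List.length_ofFn] at hj
      simp only [List.getElem_take, List.getElem_ofFn]
      have h1 : a i ≤ a ⟨j, by omega⟩ := ha (by rw [Fin.le_def]; simp; omega)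
      have h2 := hp ⟨j, by omega⟩
      omega
  · apply allPark_of_le
    · intro j hj
      have hj' : j < n := by simpa using hj
      have h1 := hp ⟨j, hj'⟩
      have h2 := h ⟨j, hj'⟩
      simp at h2 ⊢
      omega
    · simp

/-- The weakly decreasing sequences of length `l` in `{1, …, v}` that stay below the
staircase `i ↦ l + k - i`. -/
def boundedAntitone (k l v : ℕ) : Set (Fin l → ℕ) :=
  {a | Antitone a ∧ (∀ i, 1 ≤ a i ∧ a i ≤ v) ∧ ∀ i : Fin l, a i + i ≤ l + k}

theorem boundedAntitone_finite (k l v : ℕ) : (boundedAntitone k l v).Finite :=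
  (Set.finite_Icc (0 : Fin l → ℕ) (fun _ => v)).subset
    fun _ ha => ⟨fun _ => Nat.zero_le _, fun i => (ha.2.1 i).2⟩

/-- Split by whether the first entry is the maximal value `v + 1`. Dropping it lowers every index by
one, which matches the staircase for `l`; `hv` says that `v + 1` is allowed at index 0. -/
theorem boundedAntitone_succ_succ (k l v : ℕ) (hv : v ≤ l + k) :
    boundedAntitone k (l + 1) (v + 1) =
      boundedAntitone k (l + 1) v ∪ Fin.cons (v + 1) '' boundedAntitone k l (v + 1) := by
  ext a
  constructor
  · rintro ⟨h1, h2, h3⟩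
    by_cases h0 : a 0 = v + 1
    · refine Or.inr ⟨Fin.tail a, ⟨fun i j hij => h1 (Fin.succ_le_succ_iff.2 hij),
        fun i => h2 i.succ, fun i => ?_⟩, ?_⟩
      · have := h3 i.succ
        simp only [Fin.val_succ] at this
        simp only [Fin.tail]
        omega
      · rw [← h0]; exact Fin.cons_self_tail a
    · refine Or.inl ⟨h1, fun i => ⟨(h2 i).1, ?_⟩, h3⟩
      have := h1 (Fin.zero_le i)
      have := h2 0
      omega
  · rintro (⟨h1, h2, h3⟩ | ⟨b, ⟨h1, h2, h3⟩, rfl⟩)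
    · exact ⟨h1, fun i => ⟨(h2 i).1, (h2 i).2.trans (Nat.le_succ v)⟩, h3⟩
    · refine ⟨?_, ?_, ?_⟩
      · intro i j hij
        induction i using Fin.cases with
        | zero =>
          induction j using Fin.cases with
          | zero => simp
          | succ j => simpa using (h2 j).2
        | succ i =>
          induction j using Fin.cases with
          | zero => simp at hij
          | succ j => simpa using h1 (Fin.succ_le_succ_iff.1 hij)
      · intro i
        induction i using Fin.cases with
        | zero => simp
        | succ i => simpa using h2 i
      · intro i
        induction i using Fin.cases with
        | zero => simp; omega
        | succ i => have := h3 i; simp; omega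

/-- Ballot numbers, by Pascal's rule in both binomials. The range of `v` reaches one beyond the
largest value the staircase admits; this is the boundary line of the reflection principle. -/
theorem ncard_boundedAntitone (k : ℕ) : ∀ l v : ℕ, v ≤ l + k + 1 →
    (boundedAntitone k l v).ncard + (l + v - 1).choose (l + k + 1) = (l + v - 1).choose l
  | 0, v, hv => by
    have : boundedAntitone k 0 v = Set.univ := by
      ext a
      simp [boundedAntitone, Subsingleton.antitone]
    rw [this, Set.ncard_univ, Nat.card_unique, Nat.choose_eq_zero_of_lt (by omega)]
    simp
  | l + 1, 0, _ => by
    have : boundedAntitone k (l + 1) 0 = ∅ := by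
      ext a
      simp only [boundedAntitone, Set.mem_ofPred_eq, Set.mem_empty_iff_false, iff_false]
      rintro ⟨-, h, -⟩
      have := h 0
      omega
    rw [this, Set.ncard_empty, Nat.choose_eq_zero_of_lt (by omega),
      Nat.choose_eq_zero_of_lt (by omega)]
  | l + 1, v + 1, hv => by
    have h1 := ncard_boundedAntitone k (l + 1) v (by omega)
    by_cases hvl : v ≤ l + k
    · have h2 := ncard_boundedAntitone k l (v + 1) (by omega)
      rw [boundedAntitone_succ_succ k l v hvl, Set.ncard_union_eq _ (boundedAntitone_finite _ _ _)
        ((boundedAntitone_finite _ _ _).image _),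
        Set.ncard_image_of_injective _ (Fin.cons_right_injective _)]
      · have e1 : l + 1 + (v + 1) - 1 = (l + v) + 1 := by omega
        have e2 : l + 1 + v - 1 = l + v := by omega
        have e3 : l + (v + 1) - 1 = l + v := by omega
        rw [e2] at h1
        rw [e3] at h2
        rw [e1, show l + 1 + k + 1 = (l + k + 1) + 1 by omega, Nat.choose_succ_succ',
          Nat.choose_succ_succ']
        rw [show l + 1 + k + 1 = (l + k + 1) + 1 by omega] at h1
        omega
      · rw [Set.disjoint_left]
        rintro _ ⟨-, h, -⟩ ⟨b, -, rfl⟩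
        have := h 0
        simp at this
    -- On the boundary the value `v + 1` is never attained, and the two extra Pascal terms cancel by
    -- the symmetry of binomial coefficients.
    · obtain rfl : v = l + k + 1 := by omega
      have : boundedAntitone k (l + 1) (l + k + 1 + 1) = boundedAntitone k (l + 1) (l + k + 1) := by
        ext a
        refine ⟨fun ⟨h1, h2, h3⟩ => ⟨h1, fun i => ⟨(h2 i).1, ?_⟩, h3⟩,
          fun ⟨h1, h2, h3⟩ => ⟨h1, fun i => ⟨(h2 i).1, (h2 i).2.trans (Nat.le_succ _)⟩, h3⟩⟩
        have := h3 i
        omega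
      rw [this]
      have e1 : l + 1 + (l + k + 1 + 1) - 1 = (l + 1 + (l + k + 1) - 1) + 1 := by omega
      have e2 : l + 1 + (l + k + 1) - 1 = l + (l + k + 1) := by omega
      rw [e1, show l + 1 + k + 1 = (l + k + 1) + 1 by omega, Nat.choose_succ_succ',
        Nat.choose_succ_succ']
      rw [show l + 1 + k + 1 = (l + k + 1) + 1 by omega] at h1
      have e3 : (l + 1 + (l + k + 1) - 1).choose l
          = (l + 1 + (l + k + 1) - 1).choose (l + k + 1) := by
        rw [e2]; exact Nat.choose_symm_add
      omega

theorem card_descStrictlyNaples (k n : ℕ) (hk : 1 ≤ k) :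
    Finite (DescStrictlyNaples k n) ∧
    Nat.card (DescStrictlyNaples k n) + (2 * n - 1).choose (n + k + 1) =
      (2 * n - 1).choose (n + k) := by
  have hset : {a : Fin n → ℕ | Antitone a ∧ IsStrictlyNaples k a} =
      boundedAntitone k n n \ boundedAntitone (k - 1) n n := by
    ext a
    constructor
    · rintro ⟨ha, h1, h2⟩
      rw [isNaples_iff_of_antitone ha] at h1 h2
      exact ⟨⟨ha, h1⟩, fun h => h2 h.2⟩
    · rintro ⟨⟨ha, h1⟩, h2⟩
      refine ⟨ha, (isNaples_iff_of_antitone ha).2 h1, fun h => h2 ⟨ha, ?_⟩⟩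
      exact (isNaples_iff_of_antitone ha).1 h
  have hsub : boundedAntitone (k - 1) n n ⊆ boundedAntitone k n n :=
    fun a ⟨h1, h2, h3⟩ => ⟨h1, h2, fun i => (h3 i).trans (by omega)⟩
  have hcard : Nat.card (DescStrictlyNaples k n) =
      {a : Fin n → ℕ | Antitone a ∧ IsStrictlyNaples k a}.ncard := rfl
  refine ⟨Set.Finite.to_subtype (s := {a : Fin n → ℕ | Antitone a ∧ IsStrictlyNaples k a})
    (hset ▸ (boundedAntitone_finite k n n).sdiff), ?_⟩
  have h1 := ncard_boundedAntitone k n n (by omega)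
  have h2 := ncard_boundedAntitone (k - 1) n n (by omega)
  have h3 := Set.ncard_sdiff_add_ncard_of_subset hsub (boundedAntitone_finite k n n)
  rw [hcard, hset]
  rw [← two_mul] at h1 h2
  rw [show n + (k - 1) + 1 = n + k by omega] at h2
  omega

/-! ### Binary forests on an integer interval -/

/-- `E` is the set of the intervals spanned by the nodes of a sequence of binary trees with total
leaf interval `[x, y]`; the roots span the intervals between consecutive entries of `x :: L`. -/
structure IsBinaryForest (x y : ℕ) (L : List ℕ) (E : Set (ℕ × ℕ)) : Prop where
  sorted : (x :: L).Pairwise (· < ·)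
  root : (x :: L).IsChain fun a b => (a, b) ∈ E
  -- With `le`, this makes `y` the last entry, and it allows the empty forest when `x = y`.
  mem : y ∈ x :: L
  le : ∀ p ∈ L, p ≤ y
  arc : ∀ {a b}, (a, b) ∈ E → x ≤ a ∧ a < b ∧ b ≤ y ∧ ∀ p ∈ L, ¬ (a < p ∧ p < b)
  noncrossing : ∀ {a b c d}, (a, b) ∈ E → (c, d) ∈ E → a < c → c < b → b < d → False
  apex : ∀ {a b}, (a, b) ∈ E → a + 2 ≤ b → ∃ c, a < c ∧ c < b ∧ (a, c) ∈ E ∧ (c, b) ∈ E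

theorem IsBinaryForest.leaf {x y : ℕ} {L : List ℕ} {E : Set (ℕ × ℕ)}
    (h : IsBinaryForest (x + 1) y L E) :
    IsBinaryForest x y ((x + 1) :: L) (insert (x, x + 1) E) where
  sorted := by
    have := h.sorted
    simp only [List.pairwise_cons, List.mem_cons] at this ⊢
    refine ⟨?_, this⟩
    rintro p (rfl | hp)
    · omega
    · have := this.1 p hp; omega
  root := List.isChain_cons_cons.2 ⟨Set.mem_insert _ _,
    h.root.imp fun a b hab => Set.mem_insert_of_mem _ hab⟩
  mem := List.mem_cons_of_mem _ h.mem
  le := by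
    have h1 := h.mem
    have h2 := h.sorted
    simp only [List.pairwise_cons, List.mem_cons] at h1 h2 ⊢
    rintro p (rfl | hp)
    · rcases h1 with rfl | h1
      · rfl
      · exact (h2.1 _ h1).le
    · exact h.le p hp
  arc := by
    have h1 := h.mem
    have h2 := h.sorted
    simp only [List.pairwise_cons, List.mem_cons] at h1 h2
    intro a b hab
    rcases hab with hab | hab
    · simp only [Prod.mk.injEq] at hab
      refine ⟨by omega, by omega, ?_, fun p _ => by omega⟩
      rcases h1 with h1 | h1
      · omega
      · have := h2.1 _ h1; omega
    · obtain ⟨e1, e2, e3, e4⟩ := h.arc hab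
      refine ⟨by omega, e2, e3, ?_⟩
      intro p hp
      rcases List.mem_cons.1 hp with rfl | hp
      · omega
      · exact e4 p hp
  noncrossing := by
    intro a b c d hab hcd
    rcases hab with hab | hab <;> rcases hcd with hcd | hcd
    · simp only [Prod.mk.injEq] at hab hcd; omega
    · simp only [Prod.mk.injEq] at hab; omega
    · simp only [Prod.mk.injEq] at hcd
      have := h.arc hab; omega
    · exact h.noncrossing hab hcd
  apex := by
    intro a b hab h2
    rcases hab with hab | hab
    · simp only [Prod.mk.injEq] at hab; omega
    · obtain ⟨c, h3, h4, h5, h6⟩ := h.apex hab h2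
      exact ⟨c, h3, h4, Or.inr h5, Or.inr h6⟩

theorem IsBinaryForest.node {x y c q : ℕ} {L : List ℕ} {E : Set (ℕ × ℕ)}
    (h : IsBinaryForest x y (c :: q :: L) E) :
    IsBinaryForest x y (q :: L) (insert (x, q) E) where
  sorted := h.sorted.sublist (by simp)
  root := by
    have := h.root
    simp only [List.isChain_cons_cons] at this
    exact List.isChain_cons_cons.2 ⟨Set.mem_insert _ _,
      this.2.2.imp fun a b hab => Set.mem_insert_of_mem _ hab⟩
  mem := by
    have h1 := h.mem
    have h2 := h.le q (by simp)
    have h3 := h.sorted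
    simp only [List.pairwise_cons, List.mem_cons, forall_eq_or_imp] at h1 h3 ⊢
    rcases h1 with h1 | h1 | h1
    · omega
    · omega
    · exact Or.inr h1
  le p hp := h.le p (List.mem_cons_of_mem _ hp)
  arc := by
    intro a b hab
    rcases hab with hab | hab
    · simp only [Prod.mk.injEq] at hab
      have h2 := h.le q (by simp)
      have h3 := h.sorted
      simp only [List.pairwise_cons, List.mem_cons, forall_eq_or_imp] at h3 ⊢
      refine ⟨by omega, by omega, by omega, by omega, fun p hp => ?_⟩
      have := h3.2.2.1 p hp
      omega
    · obtain ⟨e1, e2, e3, e4⟩ := h.arc hab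
      exact ⟨e1, e2, e3, fun p hp => e4 p (List.mem_cons_of_mem _ hp)⟩
  noncrossing := by
    intro a b c d hab hcd
    rcases hab with hab | hab <;> rcases hcd with hcd | hcd
    · simp only [Prod.mk.injEq] at hab hcd; omega
    · simp only [Prod.mk.injEq] at hab
      have := (h.arc hcd).2.2.2 q (by simp)
      omega
    · simp only [Prod.mk.injEq] at hcd
      have := h.arc hab; omega
    · exact h.noncrossing hab hcd
  apex := by
    intro a b hab h2
    rcases hab with hab | hab
    · simp only [Prod.mk.injEq] at hab
      have h3 := h.sorted
      have h4 := h.root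
      simp only [List.pairwise_cons, List.mem_cons, forall_eq_or_imp, List.isChain_cons_cons]
        at h3 h4
      obtain ⟨rfl, rfl⟩ := hab
      exact ⟨c, h3.1.1, h3.2.1.1, Or.inr h4.1, Or.inr h4.2.1⟩
    · obtain ⟨c, h3, h4, h5, h6⟩ := h.apex hab h2
      exact ⟨c, h3, h4, Or.inr h5, Or.inr h6⟩

theorem IsBinaryForest.root_notMem {x y c q : ℕ} {L : List ℕ} {E : Set (ℕ × ℕ)}
    (h : IsBinaryForest x y (c :: q :: L) E) : (x, q) ∉ E := by
  intro hm
  have h3 := h.sorted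
  simp only [List.pairwise_cons, List.mem_cons, forall_eq_or_imp] at h3
  have := (h.arc hm).2.2.2 c (by simp)
  omega

theorem IsBinaryForest.of_leaf {x y : ℕ} {L : List ℕ} {E : Set (ℕ × ℕ)}
    (h : IsBinaryForest x y ((x + 1) :: L) E) :
    IsBinaryForest (x + 1) y L (E \ {(x, x + 1)}) := by
  have hs := h.sorted
  have hr := h.root
  have hm := h.mem
  have hl := h.le
  simp only [List.pairwise_cons, List.mem_cons, forall_eq_or_imp, List.isChain_cons_cons]
    at hs hr hm hl
  have key : ∀ {a b}, (a, b) ∈ E → (a, b) ≠ (x, x + 1) → x + 1 ≤ a := by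
    intro a b hab hne
    obtain ⟨e1, e2, e3, e4⟩ := h.arc hab
    have := e4 (x + 1) (by simp)
    simp only [ne_eq, Prod.mk.injEq] at hne
    omega
  refine ⟨?_, ?_, ?_, hl.2, ?_, ?_, ?_⟩
  · simpa using hs.2
  · refine hr.2.imp_of_mem_imp fun a b ha _ hab => ⟨hab, ?_⟩
    simp only [Set.mem_singleton_iff, Prod.mk.injEq]
    rintro ⟨rfl, -⟩
    rcases List.mem_cons.1 ha with ha | ha
    · omega
    · have := hs.1.2 a ha; omega
  · rw [List.mem_cons]
    rcases hm with rfl | hm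
    · omega
    · exact hm
  · rintro a b ⟨hab, hne⟩
    obtain ⟨e1, e2, e3, e4⟩ := h.arc hab
    exact ⟨key hab hne, e2, e3, fun p hp => e4 p (List.mem_cons_of_mem _ hp)⟩
  · intro a b c d hab hcd
    exact h.noncrossing hab.1 hcd.1
  · rintro a b ⟨hab, hne⟩ h2
    have h0 := key hab hne
    obtain ⟨c, h3, h4, h5, h6⟩ := h.apex hab h2
    refine ⟨c, h3, h4, ⟨h5, ?_⟩, ⟨h6, ?_⟩⟩ <;>
    · simp only [Set.mem_singleton_iff, Prod.mk.injEq]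
      omega

/-- Deleting the root of the first tree leaves its two subtrees, which meet at the apex `c`. -/
theorem IsBinaryForest.of_node {x y q : ℕ} {L : List ℕ} {E : Set (ℕ × ℕ)}
    (h : IsBinaryForest x y (q :: L) E) (hq : x + 2 ≤ q) :
    ∃ c, IsBinaryForest x y (c :: q :: L) (E \ {(x, q)}) := by
  have hs := h.sorted
  have hr := h.root
  have hm := h.mem
  have hl := h.le
  simp only [List.pairwise_cons, List.mem_cons, forall_eq_or_imp, List.isChain_cons_cons]
    at hs hr hm hl
  obtain ⟨c, h1, h2, h3, h4⟩ := h.apex hr.1 hq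
  refine ⟨c, ?_, ?_, List.mem_cons.2 ?_, ?_, ?_, ?_, ?_⟩
  · simp only [List.pairwise_cons, List.mem_cons, forall_eq_or_imp]
    refine ⟨⟨h1, by omega, hs.1.2⟩, ⟨h2, fun p hp => ?_⟩, hs.2⟩
    have := hs.2.1 p hp
    omega
  · simp only [List.isChain_cons_cons]
    refine ⟨⟨h3, ?_⟩, ⟨h4, ?_⟩, ?_⟩
    · simp only [Set.mem_singleton_iff, Prod.mk.injEq]; omega
    · simp only [Set.mem_singleton_iff, Prod.mk.injEq]; omega
    · refine hr.2.imp_of_mem_imp fun a b ha _ hab => ⟨hab, ?_⟩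
      simp only [Set.mem_singleton_iff, Prod.mk.injEq]
      rintro ⟨rfl, -⟩
      rcases List.mem_cons.1 ha with ha | ha
      · omega
      · have := hs.1.2 a ha; omega
  · simp only [List.mem_cons]
    tauto
  · simp only [List.mem_cons, forall_eq_or_imp]
    exact ⟨by omega, hl⟩
  · rintro a b ⟨hab, hne⟩
    obtain ⟨e1, e2, e3, e4⟩ := h.arc hab
    refine ⟨e1, e2, e3, ?_⟩
    intro p hp
    rcases List.mem_cons.1 hp with rfl | hp
    · rintro ⟨g1, g2⟩
      have hbq := e4 q (by simp)
      simp only [Set.mem_singleton_iff, Prod.mk.injEq] at hne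
      -- An arc passing over `c` would cross `(c, q)` if it starts at `x`, and `(x, c)` otherwise.
      by_cases hax : a = x
      · subst hax
        exact h.noncrossing hab h4 g1 g2 (by omega)
      · exact h.noncrossing h3 hab (by omega) g1 g2
    · exact e4 p hp
  · intro a b c d hab hcd
    exact h.noncrossing hab.1 hcd.1
  · rintro a b ⟨hab, hne⟩ g2
    obtain ⟨e1, e2, e3, e4⟩ := h.arc hab
    have := e4 q (by simp)
    obtain ⟨d, g3, g4, g5, g6⟩ := h.apex hab g2
    simp only [Set.mem_singleton_iff, Prod.mk.injEq] at hne
    refine ⟨d, g3, g4, ⟨g5, ?_⟩, ⟨g6, ?_⟩⟩ <;>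
    · simp only [Set.mem_singleton_iff, Prod.mk.injEq]
      omega

/-- The binary forests on `[x, y]` with `r` trees. -/
def binaryForests (x y r : ℕ) : Set (List ℕ × Set (ℕ × ℕ)) :=
  {G | IsBinaryForest x y G.1 G.2 ∧ G.1.length = r}

/-! ### Recursion and count of binary forests -/

theorem binaryForests_zero (x y : ℕ) :
    binaryForests x y 0 = if x = y then {([], ∅)} else ∅ := by
  ext ⟨L, E⟩
  simp only [binaryForests, Set.mem_ofPred_eq, List.length_eq_zero_iff]
  split_ifs with hxy
  · subst hxy
    simp only [Set.mem_singleton_iff, Prod.mk.injEq]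
    constructor
    · rintro ⟨h, rfl⟩
      refine ⟨rfl, Set.eq_empty_of_forall_notMem fun ⟨a, b⟩ hab => ?_⟩
      have := h.arc hab
      omega
    · rintro ⟨rfl, rfl⟩
      exact ⟨⟨by simp, by simp, by simp, by simp, by simp, by simp, by simp⟩, rfl⟩
  · simp only [Set.mem_empty_iff_false, iff_false]
    rintro ⟨h, rfl⟩
    have := h.mem
    simp at this
    omega

/-- Add a one-leaf tree on `[x, x + 1]` in front of a binary forest. -/
def addLeaf (x : ℕ) (G : List ℕ × Set (ℕ × ℕ)) : List ℕ × Set (ℕ × ℕ) :=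
  ((x + 1) :: G.1, insert (x, x + 1) G.2)

/-- Join the first two trees of a binary forest. -/
def joinTrees (x : ℕ) (G : List ℕ × Set (ℕ × ℕ)) : List ℕ × Set (ℕ × ℕ) :=
  -- The default `0` plays no role: only forests with at least two trees are joined.
  (G.1.tail, insert (x, G.1.tail.headD 0) G.2)

/-- The first tree is either a single leaf, which can be removed, or has a root, whose removal
splits it in two. -/
theorem binaryForests_succ (x y r : ℕ) :
    binaryForests x y (r + 1) =
      addLeaf x '' binaryForests (x + 1) y r ∪ joinTrees x '' binaryForests x y (r + 2) := by
  ext ⟨L, E⟩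
  constructor
  · rintro ⟨h, hL⟩
    obtain ⟨q, L, rfl⟩ := List.exists_cons_of_length_eq_add_one hL
    have hL' : L.length = r := by simpa using hL
    have hq := h.sorted
    have hr := h.root
    simp only [List.pairwise_cons, List.mem_cons, forall_eq_or_imp, List.isChain_cons_cons]
      at hq hr
    by_cases hx : q = x + 1
    · subst hx
      refine Or.inl ⟨(L, _), ⟨h.of_leaf, hL'⟩, ?_⟩
      simp only [addLeaf, Set.insert_sdiff_singleton, Prod.mk.injEq, true_and]
      exact Set.insert_eq_of_mem hr.1
    · obtain ⟨c, hc⟩ := h.of_node (by omega)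
      refine Or.inr ⟨(c :: q :: L, _), ⟨hc, by simp [hL']⟩, ?_⟩
      simp only [joinTrees, List.tail_cons, List.headD_cons, Set.insert_sdiff_singleton,
        Prod.mk.injEq, true_and]
      exact Set.insert_eq_of_mem hr.1
  · rintro (⟨⟨L', E'⟩, ⟨h, hL⟩, hG⟩ | ⟨⟨L', E'⟩, ⟨h, hL⟩, hG⟩)
    · rw [← hG]
      exact ⟨h.leaf, by simpa [addLeaf] using hL⟩
    · rw [← hG]
      obtain ⟨c, L', rfl⟩ := List.exists_cons_of_length_eq_add_one hL
      obtain ⟨q, L', rfl⟩ := List.exists_cons_of_length_eq_add_one (Nat.succ.inj hL)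
      exact ⟨h.node, by simpa [joinTrees] using hL⟩

theorem eq_of_insert_eq_insert {α : Type*} {a : α} {s t : Set α} (hs : a ∉ s) (ht : a ∉ t)
    (h : insert a s = insert a t) : s = t := by
  rw [← Set.insert_sdiff_self_of_notMem hs, h, Set.insert_sdiff_self_of_notMem ht]

theorem addLeaf_injOn (x y r : ℕ) : Set.InjOn (addLeaf x) (binaryForests (x + 1) y r) := by
  rintro ⟨L, E⟩ ⟨h, -⟩ ⟨L', E'⟩ ⟨h', -⟩ hG
  simp only [addLeaf, Prod.mk.injEq, List.cons.injEq, true_and] at hG ⊢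
  refine ⟨hG.1, eq_of_insert_eq_insert (fun hm => ?_) (fun hm => ?_) hG.2⟩
  · have := h.arc hm; omega
  · have := h'.arc hm; omega

theorem joinTrees_injOn (x y r : ℕ) : Set.InjOn (joinTrees x) (binaryForests x y (r + 2)) := by
  rintro ⟨L, E⟩ ⟨h, hL⟩ ⟨L', E'⟩ ⟨h', hL'⟩ hG
  obtain ⟨c, L, rfl⟩ := List.exists_cons_of_length_eq_add_one hL
  obtain ⟨q, L, rfl⟩ := List.exists_cons_of_length_eq_add_one (Nat.succ.inj hL)
  obtain ⟨c', L', rfl⟩ := List.exists_cons_of_length_eq_add_one hL'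
  obtain ⟨q', L', rfl⟩ := List.exists_cons_of_length_eq_add_one (Nat.succ.inj hL')
  simp only [joinTrees, Prod.mk.injEq, List.cons.injEq, List.tail_cons, List.headD_cons] at hG ⊢
  obtain ⟨⟨rfl, rfl⟩, hE⟩ := hG
  have hEE : E = E' :=
    eq_of_insert_eq_insert h.root_notMem h'.root_notMem hE
  subst hEE
  have hs := h.sorted
  have hr := h.root
  have hs' := h'.sorted
  have hr' := h'.root
  simp only [List.pairwise_cons, List.mem_cons, forall_eq_or_imp, List.isChain_cons_cons]
      at hs hr hs' hr'
  -- The lost boundary point is recovered from the arcs: `(x, c')` does not pass over `c`, nor `(x,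
  -- c)` over `c'`, so `c = c'`.
  have h1 := (h.arc hr'.1).2.2.2 c (by simp)
  have h2 := (h'.arc hr.1).2.2.2 c' (by simp)
  simp only [and_self, and_true]
  omega

theorem disjoint_addLeaf_joinTrees (x y r : ℕ) :
    Disjoint (addLeaf x '' binaryForests (x + 1) y r)
      (joinTrees x '' binaryForests x y (r + 2)) := by
  rw [Set.disjoint_left]
  rintro _ ⟨⟨L, E⟩, ⟨h, hL⟩, rfl⟩ ⟨⟨L', E'⟩, ⟨h', hL'⟩, hG⟩
  obtain ⟨c, L', rfl⟩ := List.exists_cons_of_length_eq_add_one hL'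
  obtain ⟨q, L', rfl⟩ := List.exists_cons_of_length_eq_add_one (Nat.succ.inj hL')
  simp only [joinTrees, addLeaf, Prod.mk.injEq, List.cons.injEq, List.tail_cons] at hG
  have hs := h'.sorted
  simp only [List.pairwise_cons, List.mem_cons, forall_eq_or_imp] at hs
  omega

/-- The number of binary forests with `r` trees and `s` inner nodes. -/
def numForests : ℕ → ℕ → ℕ
  | 0, 0 => 1
  | _ + 1, 0 => 0
  | 0, r + 1 => numForests 0 r
  | s + 1, r + 1 => numForests (s + 1) r + numForests s (r + 2)

theorem binaryForests_eq_empty : ∀ {r x y : ℕ}, y < x + r → binaryForests x y r = ∅ := by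
  intro r x y hy
  refine Set.eq_empty_of_forall_notMem ?_
  rintro ⟨L, E⟩ ⟨h, rfl⟩
  have hsub : L.toFinset ⊆ Finset.Ioc x y := by
    intro p hp
    rw [List.mem_toFinset] at hp
    exact Finset.mem_Ioc.2 ⟨(List.pairwise_cons.1 h.sorted).1 p hp, h.le p hp⟩
  have hc := Finset.card_le_card hsub
  have hnd : L.Nodup := (List.pairwise_cons.1 h.sorted).2.imp (fun h => h.ne)
  rw [List.toFinset_card_of_nodup hnd, Nat.card_Ioc] at hc
  have := h.mem
  rcases List.mem_cons.1 this with rfl | hm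
  · simp at hc
    simp [hc] at hy
  · have := (List.pairwise_cons.1 h.sorted).1 y hm
    simp only at hy
    omega

/-- The interval has length `r + s` because `r` binary trees with `s` inner nodes have `r + s`
leaves. Removing a leaf lowers `r`; removing a root lowers `s` and raises `r`. -/
theorem ncard_binaryForests : ∀ s r x : ℕ, (binaryForests x (x + r + s) r).Finite ∧
    (binaryForests x (x + r + s) r).ncard = numForests s r
  | 0, 0, x => by rw [binaryForests_zero]; simp [numForests]
  | s + 1, 0, x => by
    rw [binaryForests_zero, if_neg (by omega)]
    simp [numForests]
  | 0, r + 1, x => by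
    obtain ⟨h1, h2⟩ := ncard_binaryForests 0 r (x + 1)
    rw [show x + 1 + r + 0 = x + (r + 1) + 0 by omega] at h1 h2
    rw [binaryForests_succ, binaryForests_eq_empty (by omega : x + (r + 1) + 0 < x + (r + 2)),
      Set.image_empty, Set.union_empty, (addLeaf_injOn _ _ _).ncard_image, h2]
    exact ⟨h1.image _, by simp [numForests]⟩
  | s + 1, r + 1, x => by
    obtain ⟨h1, h2⟩ := ncard_binaryForests (s + 1) r (x + 1)
    obtain ⟨h3, h4⟩ := ncard_binaryForests s (r + 2) x
    rw [show x + 1 + r + (s + 1) = x + (r + 1) + (s + 1) by omega] at h1 h2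
    rw [show x + (r + 2) + s = x + (r + 1) + (s + 1) by omega] at h3 h4
    rw [binaryForests_succ, Set.ncard_union_eq (disjoint_addLeaf_joinTrees _ _ _)
      (h1.image _) (h3.image _), (addLeaf_injOn _ _ _).ncard_image,
      (joinTrees_injOn _ _ _).ncard_image, h2, h4]
    exact ⟨(h1.image _).union (h3.image _), by simp [numForests]⟩

theorem numForests_zero : ∀ r : ℕ, numForests 0 r = 1
  | 0 => by simp [numForests]
  | r + 1 => by rw [numForests, numForests_zero r]

/-- Again ballot numbers via Pascal's rule. The case `s = r = 0` is excluded because truncated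
subtraction makes the formula false there. -/
theorem numForests_add_choose : ∀ s r : ℕ, 1 ≤ s + r →
    numForests s r + (2 * s + r - 1).choose (s + r) = (2 * s + r - 1).choose s
  | 0, r, h => by
    rw [numForests_zero, Nat.choose_zero_right, Nat.choose_eq_zero_of_lt (by omega)]
  | s + 1, 0, _ => by simp [numForests]
  | s + 1, r + 1, _ => by
    have h1 := numForests_add_choose (s + 1) r (by omega)
    have h2 := numForests_add_choose s (r + 2) (by omega)
    rw [show 2 * (s + 1) + r - 1 = 2 * s + r + 1 by omega,
      show s + 1 + r = s + r + 1 by omega] at h1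
    rw [show 2 * s + (r + 2) - 1 = 2 * s + r + 1 by omega,
      show s + (r + 2) = s + r + 1 + 1 by omega] at h2
    rw [show 2 * (s + 1) + (r + 1) - 1 = (2 * s + r + 1) + 1 by omega,
      show s + 1 + (r + 1) = (s + r + 1) + 1 by omega, Nat.choose_succ_succ' _ s,
      Nat.choose_succ_succ' _ (s + r + 1), numForests]
    omega

/-! ### The circular order on the vertices of a polygon -/

section

variable {m : ℕ}

/-- The vertex reached from `u` after `a` steps. -/
def vertex (u : ZMod m) (a : ℕ) : ZMod m := u + a

theorem vertex_zero (u : ZMod m) : vertex u 0 = u := by simp [vertex]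

theorem vertex_self (u : ZMod m) : vertex u m = u := by simp [vertex]

theorem vertex_self_eq (u : ZMod m) : vertex u m = vertex u 0 := by simp [vertex]

theorem exists_vertex_eq [NeZero m] (u w : ZMod m) : ∃ a < m, vertex u a = w :=
  ⟨(w - u).val, ZMod.val_lt _, by simp [vertex]⟩

theorem vertex_inj {u : ZMod m} {a b : ℕ} (ha : a < m) (hb : b < m) :
    vertex u a = vertex u b ↔ a = b := by
  simp only [vertex, add_right_inj]
  rw [ZMod.natCast_eq_natCast_iff', Nat.mod_eq_of_lt ha, Nat.mod_eq_of_lt hb]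

theorem ZMod.sbtw_iff_val [NeZero m] {a b c : ZMod m} :
    sbtw a b c ↔ a.val < b.val ∧ b.val < c.val ∨ b.val < c.val ∧ c.val < a.val ∨
      c.val < a.val ∧ a.val < b.val := by
  obtain _ | m := m
  · exact absurd rfl (NeZero.ne 0)
  · exact Iff.rfl

theorem sbtw_vertex_iff [NeZero m] {u : ZMod m} {a b c : ℕ} (ha : a < m) (hb : b < m) (hc : c < m) :
    sbtw (vertex u a) (vertex u b) (vertex u c) ↔
      a < b ∧ b < c ∨ b < c ∧ c < a ∨ c < a ∧ a < b := by
  have key : ∀ {x : ℕ}, x < m → (vertex u x).val = u.val + x ∨ (vertex u x).val + m = u.val + x := by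
    intro x hx
    have hu := ZMod.val_lt u
    rw [vertex, ZMod.val_add, ZMod.val_natCast, Nat.mod_eq_of_lt hx]
    rcases lt_or_ge (u.val + x) m with h | h
    · exact Or.inl (Nat.mod_eq_of_lt h)
    · rw [Nat.mod_eq_sub_mod h, Nat.mod_eq_of_lt (by omega)]
      omega
  rw [ZMod.sbtw_iff_val]
  have h1 := key ha
  have h2 := key hb
  have h3 := key hc
  have h4 := ZMod.val_lt (vertex u a)
  have h5 := ZMod.val_lt (vertex u b)
  have h6 := ZMod.val_lt (vertex u c)
  omega

/-- The segment `uv` is a side of `P` with all of `P` on the arc from `v` to `u`. -/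
def IsSide (P : Set (ZMod m)) (u v : ZMod m) : Prop :=
  u ∈ P ∧ v ∈ P ∧ u ≠ v ∧ ∀ c ∈ P, ¬ sbtw u c v

theorem mem_polygonSides {P : Set (ZMod m)} {u v : ZMod m} :
    s(u, v) ∈ polygonSides P ↔ IsSide P u v ∨ IsSide P v u := by
  constructor
  · rintro ⟨a, ha, b, hb, hab, h, he⟩
    rw [Sym2.eq_iff] at he
    rcases he with ⟨rfl, rfl⟩ | ⟨rfl, rfl⟩
    · exact Or.inl ⟨ha, hb, hab, h⟩
    · exact Or.inr ⟨ha, hb, hab, h⟩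
  · rintro (⟨ha, hb, hab, h⟩ | ⟨ha, hb, hab, h⟩)
    · exact ⟨u, ha, v, hb, hab, h, rfl⟩
    · exact ⟨v, ha, u, hb, hab, h, Sym2.eq_swap⟩

theorem IsSide.mono {P Q : Set (ZMod m)} {u v : ZMod m} (h : IsSide P u v) (hQ : Q ⊆ P)
    (hu : u ∈ Q) (hv : v ∈ Q) : IsSide Q u v :=
  ⟨hu, hv, h.2.2.1, fun c hc => h.2.2.2 c (hQ hc)⟩

theorem sbtw_or_sbtw [NeZero m] {a b c : ZMod m} (hab : a ≠ b) (hbc : b ≠ c) (hac : a ≠ c) :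
    sbtw a b c ∨ sbtw c b a := by
  obtain ⟨i, hi, rfl⟩ := exists_vertex_eq 0 a
  obtain ⟨j, hj, rfl⟩ := exists_vertex_eq 0 b
  obtain ⟨k, hk, rfl⟩ := exists_vertex_eq 0 c
  simp only [ne_eq, vertex_inj, sbtw_vertex_iff, hi, hj, hk] at *
  omega

/-- The labels `0` and `m` name the same vertex, and arcs of a forest on `[0, m]` may end at either;
the condition `ham` only rules out the pair `(0, m)`. -/
theorem sbtw_vertex_of_le [NeZero m] {u : ZMod m} {a b c : ℕ} (hab : a < b) (hb : b ≤ m)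
    (ham : b < a + m) (hc : c ≤ m) :
    sbtw (vertex u a) (vertex u c) (vertex u b) ↔ a < c ∧ c < b := by
  have h0 : 0 < m := Nat.pos_of_neZero m
  rcases hb.lt_or_eq with hb | rfl
  · rcases hc.lt_or_eq with hc | rfl
    · rw [sbtw_vertex_iff (by omega) hc hb]
      omega
    · rw [vertex_self_eq, sbtw_vertex_iff (by omega) h0 hb]
      omega
  · rw [vertex_self_eq u]
    rcases hc.lt_or_eq with hc | rfl
    · rw [sbtw_vertex_iff (by omega) hc h0]
      omega
    · rw [vertex_self_eq u, sbtw_vertex_iff (by omega) h0 h0]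
      omega

theorem lt_or_lt_of_sbtw_vertex [NeZero m] {u : ZMod m} {a b c : ℕ} (hab : a < b) (hb : b ≤ m)
    (ham : b < a + m) (hc : c ≤ m) (h : sbtw (vertex u b) (vertex u c) (vertex u a)) :
    c < a ∨ b < c := by
  by_contra hcon
  rcases (by omega : c = a ∨ c = b ∨ (a < c ∧ c < b)) with rfl | rfl | h1
  · exact sbtw_irrefl_right h
  · exact sbtw_irrefl_left h
  · exact sbtw_asymm h ((sbtw_vertex_of_le hab hb ham hc).2 h1)

theorem exists_ne_of_three_le {α : Type*} {Q : Set α} (hQ : 3 ≤ Q.ncard) (a b : α) :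
    ∃ q ∈ Q, q ≠ a ∧ q ≠ b := by
  by_contra! h
  have hsub : Q ⊆ {a, b} := fun q hq => by
    by_cases ha : q = a
    · exact Or.inl ha
    · exact Or.inr (h q hq ha)
  have := Set.ncard_le_ncard hsub
  have := Set.ncard_insert_le a {b}
  rw [Set.ncard_singleton] at this
  omega

/-- The side of `P` around a vertex not in `P`. -/
theorem exists_isSide_sbtw [NeZero m] {P : Set (ZMod m)} {p x y : ZMod m} (hx : x ∈ P)
    (hy : y ∈ P) (hxy : x ≠ y) (hp : p ∉ P) : ∃ u v, IsSide P u v ∧ sbtw u p v := by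
  classical
  let I := (Finset.range m).filter fun i => vertex p i ∈ P
  have h0 : 0 < m := Nat.pos_of_neZero m
  obtain ⟨i, hi, rfl⟩ := exists_vertex_eq p x
  obtain ⟨j, hj, rfl⟩ := exists_vertex_eq p y
  have hiI : i ∈ I := by simp [I, hi, hx]
  have hjI : j ∈ I := by simp [I, hj, hy]
  obtain ⟨a, haI, ha⟩ := I.exists_min_image id ⟨i, hiI⟩
  obtain ⟨b, hbI, hb⟩ := I.exists_max_image id ⟨i, hiI⟩
  simp only [id] at ha hb
  have haI' := Finset.mem_filter.1 haI
  have hbI' := Finset.mem_filter.1 hbI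
  rw [Finset.mem_range] at haI' hbI'
  have hij : i ≠ j := by rintro rfl; exact hxy rfl
  have h1 := ha i hiI
  have h2 := ha j hjI
  have h3 := hb i hiI
  have h4 := hb j hjI
  have ha0 : a ≠ 0 := by
    rintro rfl
    rw [vertex_zero] at haI'
    exact hp haI'.2
  refine ⟨vertex p b, vertex p a, ⟨hbI'.2, haI'.2, ?_, ?_⟩, ?_⟩
  · rw [ne_eq, vertex_inj hbI'.1 haI'.1]
    omega
  · intro c hc
    obtain ⟨k, hk, rfl⟩ := exists_vertex_eq p c
    have hkI : k ∈ I := by simp [I, hk, hc]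
    have h5 := ha k hkI
    have h6 := hb k hkI
    rw [sbtw_vertex_iff hbI'.1 hk haI'.1]
    omega
  · have := (sbtw_vertex_iff (u := p) hbI'.1 h0 haI'.1).2 (by omega)
    rwa [vertex_zero] at this

/-! ### Pieces of a dissection -/

variable {D : Set (Sym2 (ZMod m))} {P Q : Set (ZMod m)}

/-- Sides of the polygon cross nothing, since one of their two open arcs contains no vertex; so
non-crossing extends from diagonals to all edges. -/
theorem IsDissection.not_sbtw [NeZero m] (hD : IsDissection D) {a b c d : ZMod m}
    (hab : s(a, b) ∈ polygonSides Set.univ ∪ D) (hcd : s(c, d) ∈ polygonSides Set.univ ∪ D)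
    (h1 : sbtw a c b) (h2 : sbtw b d a) : False := by
  rcases hab with hab | hab
  · rcases mem_polygonSides.1 hab with h | h
    · exact h.2.2.2 c trivial h1
    · exact h.2.2.2 d trivial h2
  rcases hcd with hcd | hcd
  · have h3 : sbtw c b d ∧ sbtw d a c := by
      obtain ⟨i, hi, rfl⟩ := exists_vertex_eq 0 a
      obtain ⟨j, hj, rfl⟩ := exists_vertex_eq 0 b
      obtain ⟨k, hk, rfl⟩ := exists_vertex_eq 0 c
      obtain ⟨l, hl, rfl⟩ := exists_vertex_eq 0 d
      simp only [sbtw_vertex_iff, hi, hj, hk, hl] at *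
      omega
    rcases mem_polygonSides.1 hcd with h | h
    · exact h.2.2.2 b trivial h3.1
    · exact h.2.2.2 a trivial h3.2
  · exact hD.2 _ hab _ hcd ⟨a, b, c, d, rfl, rfl, h1, h2⟩

theorem IsPiece.mem_edges (hQ : IsPiece D Q) {u v : ZMod m} (h : IsSide Q u v) :
    s(u, v) ∈ polygonSides Set.univ ∪ D :=
  hQ.2.1 (mem_polygonSides.2 (Or.inl h))

theorem IsPiece.isSide_or_isSide (hQ : IsPiece D Q) {u v : ZMod m} (hu : u ∈ Q) (hv : v ∈ Q)
    (huv : u ≠ v) (h : s(u, v) ∈ polygonSides Set.univ ∪ D) : IsSide Q u v ∨ IsSide Q v u := by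
  rcases h with h | h
  · rcases mem_polygonSides.1 h with h | h
    · exact Or.inl (h.mono (Set.subset_univ _) hu hv)
    · exact Or.inr (h.mono (Set.subset_univ _) hv hu)
  · rw [← mem_polygonSides]
    by_contra hn
    exact Set.disjoint_left.1 hQ.2.2 ⟨u, hu, v, hv, huv, rfl, hn⟩ h

/-- A vertex of `P` missing from `Q` lies beyond some side of `Q`. That side is an edge between
vertices of `P`, hence a side of `P`, although `P` has vertices strictly on both sides of it. -/
theorem IsPiece.eq_of_subset [NeZero m] (hP : IsPiece D P) (hQ : IsPiece D Q) (h : Q ⊆ P) :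
    Q = P := by
  refine h.antisymm fun z hz => ?_
  by_contra hzQ
  obtain ⟨x, hx, -⟩ := exists_ne_of_three_le hQ.1 z z
  obtain ⟨y, hy, hxy, -⟩ := exists_ne_of_three_le hQ.1 x z
  obtain ⟨u, v, hs, hzs⟩ := exists_isSide_sbtw hx hy hxy.symm hzQ
  rcases hP.isSide_or_isSide (h hs.1) (h hs.2.1) hs.2.2.1 (hQ.mem_edges hs) with h' | h'
  · exact h'.2.2.2 z hz hzs
  · obtain ⟨w, hw, hwu, hwv⟩ := exists_ne_of_three_le hQ.1 u v
    rcases sbtw_or_sbtw hwu.symm hwv hs.2.2.1 with h3 | h3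
    · exact hs.2.2.2 w hw h3
    · exact h'.2.2.2 w (h hw) h3

/-- Of two distinct pieces, the second lies beyond a side of the first. -/
theorem IsPiece.exists_isSide [NeZero m] (hD : IsDissection D) (hP : IsPiece D P)
    (hQ : IsPiece D Q) (h : Q ≠ P) : ∃ u v, IsSide P u v ∧ ∀ q ∈ Q, ¬ sbtw v q u := by
  obtain ⟨q, hq, hqP⟩ := Set.not_subset.1 fun hsub => h (hP.eq_of_subset hQ hsub)
  obtain ⟨x, hx, -⟩ := exists_ne_of_three_le hP.1 q q
  obtain ⟨y, hy, hxy, -⟩ := exists_ne_of_three_le hP.1 x q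
  obtain ⟨u, v, hs, hqs⟩ := exists_isSide_sbtw hx hy hxy.symm hqP
  refine ⟨u, v, hs, fun q' hq' hq's => ?_⟩
  have hqq : q ≠ q' := by
    rintro rfl
    exact sbtw_asymm hqs hq's
  -- The vertices `q` and `q'` of `Q` lie on opposite sides of `uv`. If an endpoint of `uv` were
  -- missing from `Q`, the side of `Q` around it would separate `u` from `v` and so cross `uv`.
  -- Hence both endpoints are in `Q` and `uv` is a side of `Q`, against `q` or `q'`.
  have key : ∀ w, w ∉ Q → (w = u ∨ w = v) → False := by
    intro w hw hwuv
    obtain ⟨a, b, hab, hwab⟩ := exists_isSide_sbtw hq hq' hqq hw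
    have h1 := hab.2.2.2 q hq
    have h2 := hab.2.2.2 q' hq'
    have h3 := hab.2.2.1
    have e1 := hP.mem_edges hs
    have e2 := hQ.mem_edges hab
    have e3 := Sym2.eq_swap ▸ e1
    have n1 : ¬ (sbtw a u b ∧ sbtw b v a) := fun h => hD.not_sbtw e2 e1 h.1 h.2
    have n2 : ¬ (sbtw a v b ∧ sbtw b u a) := fun h => hD.not_sbtw e2 e3 h.1 h.2
    clear hab e1 e2 e3 hs hx hy
    obtain ⟨i, hi, rfl⟩ := exists_vertex_eq 0 a
    obtain ⟨j, hj, rfl⟩ := exists_vertex_eq 0 b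
    obtain ⟨k, hk, rfl⟩ := exists_vertex_eq 0 u
    obtain ⟨l, hl, rfl⟩ := exists_vertex_eq 0 v
    obtain ⟨o, ho, rfl⟩ := exists_vertex_eq 0 q
    obtain ⟨p, hp, rfl⟩ := exists_vertex_eq 0 q'
    rcases hwuv with rfl | rfl
    · simp only [sbtw_vertex_iff, ne_eq, vertex_inj, hi, hj, hk, hl, ho, hp] at *
      omega
    · simp only [sbtw_vertex_iff, ne_eq, vertex_inj, hi, hj, hk, hl, ho, hp] at *
      omega
  have hu : u ∈ Q := by
    by_contra hu
    exact key u hu (Or.inl rfl)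
  have hv : v ∈ Q := by
    by_contra hv
    exact key v hv (Or.inr rfl)
  rcases hQ.isSide_or_isSide hu hv hs.2.2.1 (hP.mem_edges hs) with h' | h'
  · exact h'.2.2.2 q hq hqs
  · exact h'.2.2.2 q' hq' hq's

end

/-! ### The marked dissection of a binary forest -/

section

theorem List.IsChain.exists_mem_le_lt {R : ℕ → ℕ → Prop} {i : ℕ} : ∀ {L : List ℕ} {x : ℕ},
    (x :: L).IsChain R → x ≤ i → (∃ y ∈ L, i < y) →
    ∃ a ∈ x :: L, ∃ b ∈ L, R a b ∧ a ≤ i ∧ i < b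
  | [], _, _, _, ⟨y, hy, _⟩ => by simp at hy
  | q :: L, x, h, hx, ⟨y, hy, hiy⟩ => by
    rw [List.isChain_cons_cons] at h
    by_cases hq : i < q
    · exact ⟨x, by simp, q, by simp, h.1, hx, hq⟩
    · obtain ⟨a, ha, b, hb, hab⟩ := List.IsChain.exists_mem_le_lt h.2 (by omega : q ≤ i)
        ⟨y, by rcases List.mem_cons.1 hy with rfl | hy
               · omega
               · exact hy, hiy⟩
      exact ⟨a, List.mem_cons_of_mem _ ha, b, List.mem_cons_of_mem _ hb, hab⟩

variable {m : ℕ} {L : List ℕ} {E : Set (ℕ × ℕ)}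

theorem IsBinaryForest.pos (h : IsBinaryForest 0 m L E) {p : ℕ} (hp : p ∈ L) : 0 < p :=
  (List.pairwise_cons.1 h.sorted).1 p hp

theorem IsBinaryForest.exists_root (h : IsBinaryForest 0 m L E) {i : ℕ} (hi : i < m) :
    ∃ a ∈ 0 :: L, ∃ b ∈ L, (a, b) ∈ E ∧ a ≤ i ∧ i < b :=
  h.root.exists_mem_le_lt (Nat.zero_le i) ⟨m, by
    have := h.mem
    rcases List.mem_cons.1 this with rfl | h
    · omega
    · exact h, hi⟩

theorem IsBinaryForest.exists_lt_lt (h : IsBinaryForest 0 m L E) (hL : 3 ≤ L.length) :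
    ∃ p ∈ L, ∃ q ∈ L, 0 < p ∧ p < q ∧ q < m := by
  match L, hL, h with
  | p :: q :: s :: L, _, h =>
    have h1 := h.sorted
    have h2 := h.le s (by simp)
    simp only [List.pairwise_cons, List.mem_cons, forall_eq_or_imp] at h1
    exact ⟨p, by simp, q, by simp, by omega, by omega, by omega⟩

/-- With three or more trees there are two boundary points strictly inside `(0, m)`, over which no
arc passes. Arcs are thus short enough to be genuine segments, and an arc and its complement are
never both present. -/
theorem IsBinaryForest.add_two_le (h : IsBinaryForest 0 m L E) (hL : 3 ≤ L.length) {a b : ℕ}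
    (hab : (a, b) ∈ E) : b + 2 ≤ a + m := by
  obtain ⟨p, hp, q, hq, h1⟩ := h.exists_lt_lt hL
  obtain ⟨h2, h3, h4, h5⟩ := h.arc hab
  have := h5 p hp
  have := h5 q hq
  omega

/-- Descend from the root over `[i, i + 1]` through the apexes. -/
theorem IsBinaryForest.unit_mem (h : IsBinaryForest 0 m L E) {i : ℕ} (hi : i < m) :
    (i, i + 1) ∈ E := by
  obtain ⟨a, -, b, -, hab⟩ := h.exists_root hi
  induction hn : b - a using Nat.strong_induction_on generalizing a b with
  | _ n ih =>
    by_cases h2 : a + 2 ≤ b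
    · obtain ⟨c, h3, h4, h5, h6⟩ := h.apex hab.1 h2
      by_cases hc : i < c
      · exact ih (c - a) (by omega) a c ⟨h5, hab.2.1, hc⟩ rfl
      · exact ih (b - c) (by omega) c b ⟨h6, by omega, hab.2.2⟩ rfl
    · obtain rfl : a = i := by omega
      obtain rfl : b = a + 1 := by omega
      exact hab.1

/-- The diagonals of the polygon given by the inner nodes of a binary forest. -/
def forestDiagonals (u : ZMod m) (E : Set (ℕ × ℕ)) : Set (Sym2 (ZMod m)) :=
  {e | ∃ a b, (a, b) ∈ E ∧ a + 2 ≤ b ∧ e = s(vertex u a, vertex u b)}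

/-- The polygon whose sides are given by the roots of a binary forest. -/
def forestCenter (u : ZMod m) (L : List ℕ) : Set (ZMod m) :=
  vertex u '' {p | p ∈ L}

variable [NeZero m] {u : ZMod m}

theorem IsBinaryForest.mem_edges (h : IsBinaryForest 0 m L E) (hL : 3 ≤ L.length) {e : Sym2 (ZMod m)} :
    e ∈ polygonSides Set.univ ∪ forestDiagonals u E ↔
      ∃ a b, (a, b) ∈ E ∧ e = s(vertex u a, vertex u b) := by
  have h0 : 0 < m := Nat.pos_of_neZero m
  have hm := h.exists_lt_lt hL
  constructor
  · rintro (he | ⟨a, b, hab, -, rfl⟩)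
    · obtain ⟨x, -, y, -, hxy, hs, rfl⟩ := he
      obtain ⟨i, hi, rfl⟩ := exists_vertex_eq u x
      obtain ⟨j, hj, rfl⟩ := exists_vertex_eq u y
      refine ⟨i, i + 1, h.unit_mem hi, ?_⟩
      rw [ne_eq, vertex_inj hi hj] at hxy
      by_cases hi1 : i + 1 = m
      · rw [hi1, vertex_self_eq]
        have := hs (vertex u 0) trivial
        rw [sbtw_vertex_iff hi h0 hj] at this
        obtain rfl : j = 0 := by omega
        rfl
      · have := hs (vertex u (i + 1)) trivial
        rw [sbtw_vertex_iff hi (by omega) hj] at this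
        obtain rfl : j = i + 1 := by omega
        rfl
    · exact ⟨a, b, hab, rfl⟩
  · rintro ⟨a, b, hab, rfl⟩
    obtain ⟨-, h1, h2, -⟩ := h.arc hab
    have h3 := h.add_two_le hL hab
    by_cases h4 : a + 2 ≤ b
    · exact Or.inr ⟨a, b, hab, h4, rfl⟩
    · refine Or.inl (mem_polygonSides.2 (Or.inl ⟨trivial, trivial, ?_, ?_⟩))
      · intro hv
        obtain rfl : b = a + 1 := by omega
        rcases h2.lt_or_eq with h2 | h2
        · rw [vertex_inj (by omega) h2] at hv
          omega
        · rw [h2, vertex_self_eq, vertex_inj (by omega) h0] at hv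
          omega
      · intro c _
        obtain ⟨k, hk, rfl⟩ := exists_vertex_eq u c
        rw [sbtw_vertex_of_le h1 h2 (by omega) hk.le]
        omega

theorem IsBinaryForest.not_sbtw (h : IsBinaryForest 0 m L E) (hL : 3 ≤ L.length) {a b c d : ℕ}
    (hab : (a, b) ∈ E) (hcd : (c, d) ∈ E ∨ (d, c) ∈ E)
    (h1 : sbtw (vertex u a) (vertex u c) (vertex u b))
    (h2 : sbtw (vertex u b) (vertex u d) (vertex u a)) : False := by
  obtain ⟨-, h3, h4, -⟩ := h.arc hab
  have h5 := h.add_two_le hL hab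
  have h6 : c ≤ m ∧ d ≤ m := by
    rcases hcd with hcd | hcd
    · have := h.arc hcd; omega
    · have := h.arc hcd; omega
  rw [sbtw_vertex_of_le h3 h4 (by omega) h6.1] at h1
  have h7 := lt_or_lt_of_sbtw_vertex h3 h4 (by omega) h6.2 h2
  rcases hcd with hcd | hcd
  · have := h.arc hcd
    exact h.noncrossing hab hcd h1.1 h1.2 (by omega)
  · have := h.arc hcd
    exact h.noncrossing hcd hab (by omega) h1.1 h1.2

theorem IsBinaryForest.isDissection (h : IsBinaryForest 0 m L E) (hL : 3 ≤ L.length) :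
    IsDissection (forestDiagonals u E) := by
  have h0 : 0 < m := Nat.pos_of_neZero m
  constructor
  · rintro _ ⟨a, b, hab, h2, rfl⟩
    obtain ⟨-, h3, h4, -⟩ := h.arc hab
    have h5 := h.add_two_le hL hab
    have h6 : sbtw (vertex u a) (vertex u (a + 1)) (vertex u b) :=
      (sbtw_vertex_of_le h3 h4 (by omega) (by omega)).2 (by omega)
    have h7 : ∃ c, sbtw (vertex u b) c (vertex u a) := by
      rcases h4.lt_or_eq with h4 | rfl
      · by_cases h8 : b + 1 = m
        · exact ⟨vertex u 0, (sbtw_vertex_iff h4 h0 (by omega)).2 (by omega)⟩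
        · exact ⟨vertex u (b + 1), (sbtw_vertex_iff h4 (by omega) (by omega)).2 (by omega)⟩
      · rw [vertex_self_eq]
        exact ⟨vertex u 1, (sbtw_vertex_iff h0 (by omega) (by omega)).2 (by omega)⟩
    refine ⟨_, trivial, _, trivial, ?_, rfl, ?_⟩
    · intro hv
      rw [hv] at h6
      exact sbtw_irrefl_left_right h6
    · rw [mem_polygonSides]
      rintro (hs | hs)
      · exact hs.2.2.2 _ trivial h6
      · obtain ⟨c, hc⟩ := h7
        exact hs.2.2.2 _ trivial hc
  · rintro _ ⟨a, b, hab, -, rfl⟩ _ ⟨c, d, hcd, -, rfl⟩ ⟨a', b', c', d', h1, h2, h3, h4⟩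
    rw [Sym2.eq_iff] at h1 h2
    rcases h1 with ⟨rfl, rfl⟩ | ⟨rfl, rfl⟩ <;> rcases h2 with ⟨rfl, rfl⟩ | ⟨rfl, rfl⟩
    · exact h.not_sbtw hL hab (Or.inl hcd) h3 h4
    · exact h.not_sbtw hL hab (Or.inr hcd) h3 h4
    · exact h.not_sbtw hL hab (Or.inr hcd) h4 h3
    · exact h.not_sbtw hL hab (Or.inl hcd) h4 h3

theorem IsBinaryForest.exists_of_isSide (h : IsBinaryForest 0 m L E) {w z : ZMod m}
    (hs : IsSide (forestCenter u L) w z) :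
    ∃ a b, (a, b) ∈ E ∧ w = vertex u a ∧ z = vertex u b := by
  have h0 : 0 < m := Nat.pos_of_neZero m
  obtain ⟨⟨p, hp, rfl⟩, ⟨q, hq, rfl⟩, hne, hs⟩ := hs
  -- The label `m` is replaced by `0`, because a root has to start at this vertex.
  obtain ⟨p', hpm, hp', hpv⟩ : ∃ p' < m, p' ∈ 0 :: L ∧ vertex u p = vertex u p' := by
    rcases (h.le p hp).lt_or_eq with h1 | rfl
    · exact ⟨p, h1, List.mem_cons_of_mem _ hp, rfl⟩
    · exact ⟨0, h0, by simp, vertex_self_eq u⟩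
  obtain ⟨a, ha, b, hb, hab, hap, hpb⟩ := h.exists_root hpm
  obtain ⟨-, h1, h2, h3⟩ := h.arc hab
  obtain rfl : a = p' := by
    rcases List.mem_cons.1 hp' with rfl | hp'
    · omega
    · have := h3 p' hp'; omega
  rw [hpv] at hne hs ⊢
  refine ⟨a, b, hab, rfl, ?_⟩
  have h4 := h3 q hq
  have h5 := h.pos hq
  have h6 := h.le q hq
  have h7 := hs (vertex u b) ⟨b, hb, rfl⟩
  have h8 : q ≠ a := by rintro rfl; exact hne rfl
  have h9 : ¬ (q = m ∧ a = 0) := by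
    rintro ⟨rfl, rfl⟩
    exact hne (vertex_self_eq u).symm
  rcases lt_trichotomy q b with hqb | rfl | hqb
  · exfalso
    rcases h2.lt_or_eq with h2 | rfl
    · rw [sbtw_vertex_iff hpm h2 (by omega)] at h7
      omega
    · rw [vertex_self_eq, sbtw_vertex_iff hpm h0 (by omega)] at h7
      omega
  · rfl
  · exfalso
    rw [sbtw_vertex_of_le (by omega) h6 (by omega) h2] at h7
    omega

theorem IsBinaryForest.isSide_edge (h : IsBinaryForest 0 m L E) (hL : 3 ≤ L.length) :
    IsSide (forestCenter u L) (vertex u 0) (vertex u (L.headD 0)) := by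
  have h0 : 0 < m := Nat.pos_of_neZero m
  obtain ⟨p, hp, q, hq, hpq⟩ := h.exists_lt_lt hL
  match L, hL with
  | x :: L, _ =>
    have hs := h.sorted
    simp only [List.pairwise_cons, List.mem_cons, forall_eq_or_imp] at hs hp hq
    have hxm : x < m := by
      rcases hp with rfl | hp
      · omega
      · have := hs.2.1 p hp; omega
    refine ⟨⟨m, ?_, vertex_self_eq u⟩, ⟨x, by simp, rfl⟩, ?_, ?_⟩
    · have := h.mem
      rcases List.mem_cons.1 this with h1 | h1
      · omega
      · exact h1
    · rw [List.headD_cons, ne_eq, vertex_inj h0 hxm]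
      omega
    · rintro _ ⟨c, hc, rfl⟩
      rw [List.headD_cons, sbtw_vertex_of_le hs.1.1 hxm.le (by omega) (h.le c hc)]
      rcases List.mem_cons.1 hc with rfl | hc
      · omega
      · have := hs.2.1 c hc; omega

theorem vertex_injOn : Set.InjOn (vertex u) {p | 0 < p ∧ p ≤ m} := by
  have h0 : 0 < m := Nat.pos_of_neZero m
  rintro a ⟨ha, ha'⟩ b ⟨hb, hb'⟩ hab
  rcases ha'.lt_or_eq with ha' | rfl <;> rcases hb'.lt_or_eq with hb' | rfl
  · exact (vertex_inj ha' hb').1 hab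
  · rw [vertex_self_eq, vertex_inj ha' h0] at hab; omega
  · rw [vertex_self_eq, vertex_inj h0 hb'] at hab; omega
  · rfl

theorem IsBinaryForest.ncard_forestCenter (h : IsBinaryForest 0 m L E) :
    (forestCenter u L).ncard = L.length := by
  have hnd : L.Nodup := (List.pairwise_cons.1 h.sorted).2.imp (fun h => h.ne)
  have : {p | p ∈ L} = (L.toFinset : Set ℕ) := by ext; simp
  have hinj : Set.InjOn (vertex u) {p | p ∈ L} :=
    fun p hp q hq e => vertex_injOn ⟨h.pos hp, h.le p hp⟩ ⟨h.pos hq, h.le q hq⟩ e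
  rw [forestCenter, hinj.ncard_image, this,
    Set.ncard_coe_finset, List.toFinset_card_of_nodup hnd]

theorem IsBinaryForest.isPiece_center (h : IsBinaryForest 0 m L E) (hL : 3 ≤ L.length) :
    IsPiece (forestDiagonals u E) (forestCenter u L) := by
  refine ⟨by rwa [h.ncard_forestCenter], ?_, ?_⟩
  · rintro _ ⟨w, hw, z, hz, hwz, hs, rfl⟩
    obtain ⟨a, b, hab, rfl, rfl⟩ := h.exists_of_isSide ⟨hw, hz, hwz, hs⟩
    exact (h.mem_edges hL).2 ⟨a, b, hab, rfl⟩
  · rw [Set.disjoint_left]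
    rintro _ ⟨w, hw, z, hz, hwz, rfl, hs⟩ ⟨a, b, hab, h2, he⟩
    rw [he] at hs
    refine hs (mem_polygonSides.2 (Or.inl ⟨?_, ?_, ?_, ?_⟩))
    · rcases Sym2.eq_iff.1 he with ⟨rfl, rfl⟩ | ⟨rfl, rfl⟩ <;> assumption
    · rcases Sym2.eq_iff.1 he with ⟨rfl, rfl⟩ | ⟨rfl, rfl⟩ <;> assumption
    · rcases Sym2.eq_iff.1 he with ⟨rfl, rfl⟩ | ⟨rfl, rfl⟩
      · exact hwz
      · exact hwz.symm
    · rintro _ ⟨c, hc, rfl⟩ hc'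
      obtain ⟨-, h3, h4, h5⟩ := h.arc hab
      have h6 := h.add_two_le hL hab
      rw [sbtw_vertex_of_le h3 h4 (by omega) (h.le c hc)] at hc'
      exact h5 c hc hc'

/-- A triangle has no diagonals, so it is a piece as soon as its sides are edges. -/
theorem isPiece_triple {D : Set (Sym2 (ZMod m))} {a b c : ZMod m} (h : sbtw a b c)
    (hab : s(a, b) ∈ polygonSides Set.univ ∪ D) (hbc : s(b, c) ∈ polygonSides Set.univ ∪ D)
    (hca : s(c, a) ∈ polygonSides Set.univ ∪ D) : IsPiece D {a, b, c} := by
  have n1 : a ≠ b := fun e => sbtw_irrefl_left (e ▸ h)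
  have n2 : b ≠ c := fun e => sbtw_irrefl_right (e ▸ h)
  have n3 : a ≠ c := fun e => sbtw_irrefl_left_right (e ▸ h)
  have hs : ∀ x ∈ ({a, b, c} : Set (ZMod m)), ∀ y ∈ ({a, b, c} : Set (ZMod m)), x ≠ y →
      s(x, y) ∈ polygonSides ({a, b, c} : Set (ZMod m)) ∧
      s(x, y) ∈ polygonSides Set.univ ∪ D := by
    have s1 : IsSide {a, b, c} a b := by
      refine ⟨by simp, by simp, n1, ?_⟩
      rintro d (rfl | rfl | rfl) hd
      · exact sbtw_irrefl_left hd
      · exact sbtw_irrefl_right hd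
      · exact sbtw_asymm hd h.cyclic_left
    have s2 : IsSide {a, b, c} b c := by
      refine ⟨by simp, by simp, n2, ?_⟩
      rintro d (rfl | rfl | rfl) hd
      · exact sbtw_asymm hd h.cyclic_right
      · exact sbtw_irrefl_left hd
      · exact sbtw_irrefl_right hd
    have s3 : IsSide {a, b, c} c a := by
      refine ⟨by simp, by simp, n3.symm, ?_⟩
      rintro d (rfl | rfl | rfl) hd
      · exact sbtw_irrefl_right hd
      · exact sbtw_asymm hd h
      · exact sbtw_irrefl_left hd
    have t1 := mem_polygonSides.2 (Or.inl s1)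
    have t2 := mem_polygonSides.2 (Or.inl s2)
    have t3 := mem_polygonSides.2 (Or.inl s3)
    rintro x (rfl | rfl | rfl) y (rfl | rfl | rfl) hxy
    · exact absurd rfl hxy
    · exact ⟨t1, hab⟩
    · rw [Sym2.eq_swap]; exact ⟨t3, hca⟩
    · rw [Sym2.eq_swap]; exact ⟨t1, hab⟩
    · exact absurd rfl hxy
    · exact ⟨t2, hbc⟩
    · exact ⟨t3, hca⟩
    · rw [Sym2.eq_swap]; exact ⟨t2, hbc⟩
    · exact absurd rfl hxy
  refine ⟨?_, ?_, ?_⟩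
  · rw [Set.ncard_insert_of_notMem (by simp [n1, n3]), Set.ncard_pair n2]
  · rintro _ ⟨x, hx, y, hy, hxy, -, rfl⟩
    exact (hs x hx y hy hxy).2
  · rw [Set.disjoint_left]
    rintro _ ⟨x, hx, y, hy, hxy, rfl, hn⟩ -
    exact hn (hs x hx y hy hxy).1

/-- Induction on the length of the arc. A piece within `[a, b]` is the triangle on `a`, the apex and
`b`, or lies beyond a side of it; that side is one of the two shorter arcs, because the piece has a
vertex strictly between `a` and `b`. -/
theorem IsBinaryForest.ncard_of_arc (h : IsBinaryForest 0 m L E) (hL : 3 ≤ L.length)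
    {Q : Set (ZMod m)} (hQ : IsPiece (forestDiagonals u E) Q) {a b : ℕ} (hab : (a, b) ∈ E)
    (hs : ∀ q ∈ Q, ¬ sbtw (vertex u b) q (vertex u a)) : Q.ncard = 3 := by
  induction hn : b - a using Nat.strong_induction_on generalizing a b with
  | _ n ih =>
    obtain ⟨-, h1, h2, -⟩ := h.arc hab
    have h3 := h.add_two_le hL hab
    have hvab : vertex u a ≠ vertex u b := by
      intro hv
      have h0 : 0 < m := Nat.pos_of_neZero m
      rcases h2.lt_or_eq with h2 | rfl
      · rw [vertex_inj (by omega) h2] at hv; omega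
      · rw [vertex_self_eq, vertex_inj (by omega) h0] at hv; omega
    obtain ⟨q, hq, hqa, hqb⟩ := exists_ne_of_three_le hQ.1 (vertex u a) (vertex u b)
    have hq' : sbtw (vertex u a) q (vertex u b) :=
      (sbtw_or_sbtw hqa.symm hqb hvab).resolve_right (hs q hq)
    have h4 : a + 2 ≤ b := by
      obtain ⟨k, hk, rfl⟩ := exists_vertex_eq u q
      rw [sbtw_vertex_of_le h1 h2 (by omega) hk.le] at hq'
      omega
    obtain ⟨c, hac, hcb, hE1, hE2⟩ := h.apex hab h4
    have hc : sbtw (vertex u a) (vertex u c) (vertex u b) :=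
      (sbtw_vertex_of_le h1 h2 (by omega) (by omega)).2 ⟨hac, hcb⟩
    have hT : IsPiece (forestDiagonals u E) {vertex u a, vertex u c, vertex u b} :=
      isPiece_triple hc ((h.mem_edges hL).2 ⟨_, _, hE1, rfl⟩)
        ((h.mem_edges hL).2 ⟨_, _, hE2, rfl⟩) ((h.mem_edges hL).2 ⟨_, _, hab, Sym2.eq_swap⟩)
    by_cases hQT : Q = {vertex u a, vertex u c, vertex u b}
    · rw [hQT, Set.ncard_insert_of_notMem, Set.ncard_pair]
      · exact fun e => sbtw_irrefl_right (e ▸ hc)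
      · rintro (e | e)
        · exact sbtw_irrefl_left (e ▸ hc)
        · exact hvab e
    · obtain ⟨x, y, hxy, hQs⟩ := hT.exists_isSide (h.isDissection hL) hQ hQT
      obtain ⟨hx, hy, hne, hs'⟩ := hxy
      rcases hx with rfl | rfl | rfl <;> rcases hy with rfl | rfl | rfl
      · exact absurd rfl hne
      · exact ih (c - a) (by omega) hE1 hQs rfl
      · exact absurd hc (hs' _ (by simp))
      · exact absurd hc.cyclic_left (hs' _ (by simp))
      · exact absurd rfl hne
      · exact ih (b - c) (by omega) hE2 hQs rfl
      · exact absurd hq' (hQs q hq)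
      · exact absurd hc.cyclic_right (hs' _ (by simp))
      · exact absurd rfl hne

/-- The marked dissection of a binary forest, whose center contains `u`. -/
def IsBinaryForest.markedDissection (h : IsBinaryForest 0 m L E) {r : ℕ} (hr : 3 ≤ r)
    (hL : L.length = r) (u : ZMod m) : MarkedDissection r m where
  diagonals := forestDiagonals u E
  isDissection := h.isDissection (by omega)
  center := forestCenter u L
  isPiece_center := h.isPiece_center (by omega)
  ncard_center := by rw [h.ncard_forestCenter, hL]
  ncard_of_ne Q hQ hne := by
    have hL3 : 3 ≤ L.length := by omega
    obtain ⟨x, y, hxy, hQs⟩ := (h.isPiece_center hL3).exists_isSide (h.isDissection hL3) hQ hne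
    obtain ⟨a, b, hab, rfl, rfl⟩ := h.exists_of_isSide hxy
    exact h.ncard_of_arc hL3 hQ hab hQs
  edge := s(vertex u 0, vertex u (L.headD 0))
  edge_mem := mem_polygonSides.2 (Or.inl (h.isSide_edge (by omega)))

end

/-! ### Rotations of marked dissections of binary forests -/

section

variable {m : ℕ} {L L' : List ℕ} {E E' : Set (ℕ × ℕ)}

theorem image_forestDiagonals (u c : ZMod m) (E : Set (ℕ × ℕ)) :
    Sym2.map (fun v => v + c) '' forestDiagonals u E = forestDiagonals (u + c) E := by
  have hv : ∀ a : ℕ, vertex u a + c = vertex (u + c) a := fun a => by simp only [vertex]; ring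
  ext e
  constructor
  · rintro ⟨_, ⟨a, b, hab, h2, rfl⟩, rfl⟩
    exact ⟨a, b, hab, h2, by simp only [Sym2.map_mk, hv]⟩
  · rintro ⟨a, b, hab, h2, rfl⟩
    exact ⟨_, ⟨a, b, hab, h2, rfl⟩, by simp only [Sym2.map_mk, hv]⟩

theorem image_forestCenter (u c : ZMod m) (L : List ℕ) :
    (fun v => v + c) '' forestCenter u L = forestCenter (u + c) L := by
  have hv : ∀ a : ℕ, vertex u a + c = vertex (u + c) a := fun a => by simp only [vertex]; ring
  simp only [forestCenter, Set.image_image, hv]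

theorem IsSide.not_symm [NeZero m] {P : Set (ZMod m)} (hP : 3 ≤ P.ncard) {u v : ZMod m}
    (h : IsSide P u v) (h' : IsSide P v u) : False := by
  obtain ⟨w, hw, hwu, hwv⟩ := exists_ne_of_three_le hP u v
  rcases sbtw_or_sbtw hwu.symm hwv h.2.2.1 with h3 | h3
  · exact h.2.2.2 w hw h3
  · exact h'.2.2.2 w hw h3

theorem IsSide.right_unique [NeZero m] {P : Set (ZMod m)} {u v w : ZMod m}
    (h : IsSide P u v) (h' : IsSide P u w) : v = w := by
  by_contra hvw
  rcases sbtw_or_sbtw h.2.2.1 hvw h'.2.2.1 with h3 | h3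
  · exact h'.2.2.2 v h.2.1 h3
  · exact h.2.2.2 w h'.2.1 h3.cyclic_right

theorem eq_or_of_vertex_eq [NeZero m] {u : ZMod m} {a b : ℕ} (ha : a ≤ m) (hb : b ≤ m)
    (h : vertex u a = vertex u b) : a = b ∨ (a = 0 ∧ b = m) ∨ (a = m ∧ b = 0) := by
  have h0 : 0 < m := Nat.pos_of_neZero m
  rcases ha.lt_or_eq with ha | rfl <;> rcases hb.lt_or_eq with hb | rfl
  · exact Or.inl ((vertex_inj ha hb).1 h)
  · rw [vertex_self_eq, vertex_inj ha h0] at h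
    exact Or.inr (Or.inl ⟨h, rfl⟩)
  · rw [vertex_self_eq, vertex_inj h0 hb] at h
    exact Or.inr (Or.inr ⟨rfl, h.symm⟩)
  · exact Or.inl rfl

/-- Recovers the arcs from `L` and the diagonals. Of the two arcs spanned by a segment, only one can
avoid passing over `L`. -/
theorem IsBinaryForest.mem_iff [NeZero m] (h : IsBinaryForest 0 m L E) (hL : 3 ≤ L.length)
    (u : ZMod m) {a b : ℕ} :
    (a, b) ∈ E ↔ a < b ∧ b ≤ m ∧ (∀ p ∈ L, ¬ (a < p ∧ p < b)) ∧
      s(vertex u a, vertex u b) ∈ polygonSides Set.univ ∪ forestDiagonals u E := by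
  rw [h.mem_edges hL]
  constructor
  · intro hab
    obtain ⟨-, h1, h2, h3⟩ := h.arc hab
    exact ⟨h1, h2, h3, a, b, hab, rfl⟩
  · rintro ⟨h1, h2, h3, c, d, hcd, he⟩
    obtain ⟨-, h4, h5, h6⟩ := h.arc hcd
    obtain ⟨p, hp, q, hq, hpq⟩ := h.exists_lt_lt hL
    have e1 := h3 p hp
    have e2 := h3 q hq
    have e3 := h6 p hp
    have e4 := h6 q hq
    rcases Sym2.eq_iff.1 he with ⟨h7, h8⟩ | ⟨h7, h8⟩
    · have h9 := eq_or_of_vertex_eq (by omega) (by omega) h7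
      have h10 := eq_or_of_vertex_eq (by omega) (by omega) h8
      obtain rfl : a = c := by omega
      obtain rfl : b = d := by omega
      exact hcd
    · have h9 := eq_or_of_vertex_eq (by omega) (by omega) h7
      have h10 := eq_or_of_vertex_eq (by omega) (by omega) h8
      omega

theorem IsBinaryForest.eq_of_rotated [NeZero m] (h : IsBinaryForest 0 m L E)
    (h' : IsBinaryForest 0 m L' E') {r : ℕ} (hr : 3 ≤ r) (hL : L.length = r)
    (hL' : L'.length = r) {u : ZMod m}
    (hrot : (h.markedDissection hr hL u).Rotated (h'.markedDissection hr hL' u)) :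
    L = L' ∧ E = E' := by
  obtain ⟨c, h1, h2, h3⟩ := hrot
  change forestDiagonals u E' = Sym2.map (fun v => v + c) '' forestDiagonals u E at h1
  change forestCenter u L' = (fun v => v + c) '' forestCenter u L at h2
  change s(vertex u 0, vertex u (L'.headD 0)) =
    Sym2.map (fun v => v + c) s(vertex u 0, vertex u (L.headD 0)) at h3
  have hv : ∀ a : ℕ, vertex u a + c = vertex (u + c) a := fun a => by simp only [vertex]; ring
  rw [image_forestDiagonals] at h1
  rw [image_forestCenter] at h2
  simp only [Sym2.map_mk, hv] at h3
  have s1 := h.isSide_edge (u := u + c) (by omega)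
  have s2 := h'.isSide_edge (u := u) (by omega)
  rw [← h2] at s1
  -- The rotation maps marked edge to marked edge. If it preserves the initial vertex, then `c = 0`;
  -- if it exchanged the endpoints, both orientations would bound the center, which is impossible
  -- with three or more vertices.
  have hc : c = 0 := by
    rcases Sym2.eq_iff.1 h3 with ⟨h4, h5⟩ | ⟨h4, h5⟩
    · simpa [vertex] using h4
    · rw [← h4, ← h5] at s1
      refine (IsSide.not_symm ?_ s1 s2).elim
      rw [h'.ncard_forestCenter]
      omega
  subst hc
  rw [add_zero] at h1 h2
  have hmem : ∀ p, p ∈ L ↔ p ∈ L' := by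
    intro p
    constructor
    · intro hp
      have : vertex u p ∈ forestCenter u L' := h2 ▸ ⟨p, hp, rfl⟩
      obtain ⟨q, hq, hqp⟩ := this
      rwa [← vertex_injOn ⟨h'.pos hq, h'.le q hq⟩ ⟨h.pos hp, h.le p hp⟩ hqp]
    · intro hp
      have : vertex u p ∈ forestCenter u L := h2 ▸ ⟨p, hp, rfl⟩
      obtain ⟨q, hq, hqp⟩ := this
      rwa [← vertex_injOn ⟨h.pos hq, h.le q hq⟩ ⟨h'.pos hp, h'.le p hp⟩ hqp]
  have hLL : L = L' := by
    have p1 := (List.pairwise_cons.1 h.sorted).2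
    have p2 := (List.pairwise_cons.1 h'.sorted).2
    have hperm : L.Perm L' := (List.perm_ext_iff_of_nodup (p1.imp fun h => h.ne)
      (p2.imp fun h => h.ne)).2 hmem
    exact hperm.eq_of_pairwise (fun a b _ _ h h' => absurd h h'.asymm) p1 p2
  refine ⟨hLL, ?_⟩
  subst hLL
  ext ⟨a, b⟩
  rw [h.mem_iff (by omega) u, h'.mem_iff (by omega) u, h1]

/-! ### The binary forest of a marked dissection -/

/-- The points of `[a, b]` that are not covered by a smaller arc of `e`. -/
def visiblePoints (e : ℕ → ℕ → Prop) (a b : ℕ) : Set ℕ :=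
  {w | a ≤ w ∧ w ≤ b ∧ ∀ i j, a ≤ i → i < w → w < j → j ≤ b → e i j → i = a ∧ j = b}

/-- The farthest `c < b` joined to `a` is visible: an arc over `c` crosses `(a, c)` or starts at
`a`, and then it is `(a, b)` by maximality. -/
theorem exists_mem_visiblePoints {e : ℕ → ℕ → Prop} {a b : ℕ}
    (hcross : ∀ i k j l, a ≤ i → i < k → k < j → j < l → l ≤ b → e i j → e k l → False)
    (hunit : ∀ i, a ≤ i → i < b → e i (i + 1)) (h2 : a + 2 ≤ b) :
    ∃ c ∈ visiblePoints e a b, a < c ∧ c < b ∧ e a c := by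
  classical
  obtain ⟨c, hc, hmax⟩ := ((Finset.Ioo a b).filter fun c => e a c).exists_max_image id
    ⟨a + 1, by simp only [Finset.mem_filter, Finset.mem_Ioo]
               exact ⟨by omega, hunit a le_rfl (by omega)⟩⟩
  simp only [Finset.mem_filter, Finset.mem_Ioo, id] at hc hmax
  refine ⟨c, ⟨by omega, by omega, ?_⟩, hc.1.1, hc.1.2, hc.2⟩
  intro i j hi hic hcj hj hij
  rcases hi.lt_or_eq with hi | rfl
  · exact (hcross a i c j le_rfl hi hic hcj hj hc.2 hij).elim
  · refine ⟨rfl, ?_⟩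
    by_contra hjb
    have := hmax j ⟨by omega, hij⟩
    omega

/-- The longest arc from `x` that ends in `(x, y]` must end at `y`, since otherwise its endpoint
would be a visible point between them. -/
theorem rel_of_visiblePoints {e : ℕ → ℕ → Prop} {a b : ℕ}
    (hcross : ∀ i k j l, a ≤ i → i < k → k < j → j < l → l ≤ b → e i j → e k l → False)
    (hunit : ∀ i, a ≤ i → i < b → e i (i + 1)) (hab : e a b) {x y : ℕ}
    (hx : x ∈ visiblePoints e a b) (hy : y ∈ visiblePoints e a b) (hxy : x < y)
    (hno : ∀ z ∈ visiblePoints e a b, ¬ (x < z ∧ z < y)) : e x y := by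
  classical
  by_cases hab' : x = a ∧ y = b
  · rwa [hab'.1, hab'.2]
  obtain ⟨hx1, hx2, hx3⟩ := hx
  obtain ⟨hy1, hy2, hy3⟩ := hy
  obtain ⟨w, hw, hmax⟩ := ((Finset.Ioc x y).filter fun c => e x c).exists_max_image id
    ⟨x + 1, by simp only [Finset.mem_filter, Finset.mem_Ioc]
               exact ⟨by omega, hunit x hx1 (by omega)⟩⟩
  simp only [Finset.mem_filter, Finset.mem_Ioc, id] at hw hmax
  rcases hw.1.2.lt_or_eq with hwy | rfl
  · refine (hno w ⟨by omega, by omega, ?_⟩ ⟨hw.1.1, hwy⟩).elim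
    intro i j hi hiw hwj hj hij
    rcases lt_trichotomy i x with hix | rfl | hix
    · exact hx3 i j hi hix (by omega) hj hij
    · by_cases hjy : j ≤ y
      · have := hmax j ⟨by omega, hij⟩
        omega
      · exact hy3 i j hi hxy (by omega) hj hij
    · exact (hcross x i w j hx1 hix hiw hwj hj hw.2 hij).elim
  · exact hw.2

end

section

variable {m : ℕ} [NeZero m] {D : Set (Sym2 (ZMod m))} {u : ZMod m} {a b : ℕ}

theorem isSide_univ_vertex_succ (hm : 2 ≤ m) {i : ℕ} (hi : i < m) :
    IsSide Set.univ (vertex u i) (vertex u (i + 1)) := by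
  refine ⟨trivial, trivial, fun h => ?_, fun c _ => ?_⟩
  · have := eq_or_of_vertex_eq (by omega) (by omega) h
    omega
  · obtain ⟨k, hk, rfl⟩ := exists_vertex_eq u c
    rw [sbtw_vertex_of_le (by omega) (by omega) (by omega) hk.le]
    omega

theorem IsDissection.not_crossing (hD : IsDissection D) (hb : b ≤ m) (ham : b < a + m)
    {i j k l : ℕ} (hi : a ≤ i) (hik : i < k) (hkj : k < j) (hjl : j < l) (hl : l ≤ b)
    (hij : s(vertex u i, vertex u j) ∈ polygonSides Set.univ ∪ D)
    (hkl : s(vertex u k, vertex u l) ∈ polygonSides Set.univ ∪ D) : False :=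
  hD.not_sbtw hij hkl
    ((sbtw_vertex_of_le (by omega) (by omega) (by omega) (by omega)).2 ⟨hik, hkj⟩)
    ((sbtw_vertex_of_le (by omega) (by omega) (by omega) (by omega)).2
      (⟨by omega, hjl⟩ : i < j ∧ j < l)).cyclic_left

/-- The visible points of an arc form a piece. -/
theorem IsDissection.isPiece_visiblePoints (hD : IsDissection D) (hb : b ≤ m) (ham : b < a + m)
    (h2 : a + 2 ≤ b) (hab : s(vertex u a, vertex u b) ∈ polygonSides Set.univ ∪ D) :
    IsPiece D (vertex u '' visiblePoints
      (fun i j => s(vertex u i, vertex u j) ∈ polygonSides Set.univ ∪ D) a b) := by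
  set e : ℕ → ℕ → Prop := fun i j => s(vertex u i, vertex u j) ∈ polygonSides Set.univ ∪ D with he
  have hcross : ∀ i k j l, a ≤ i → i < k → k < j → j < l → l ≤ b → e i j → e k l → False :=
    fun i k j l h1 h2 h3 h4 h5 h6 h7 => hD.not_crossing hb ham h1 h2 h3 h4 h5 h6 h7
  have hunit : ∀ i, a ≤ i → i < b → e i (i + 1) := fun i h1 h2 =>
    Or.inl (mem_polygonSides.2 (Or.inl (isSide_univ_vertex_succ (by omega) (by omega))))
  have hva : a ∈ visiblePoints e a b := ⟨le_rfl, by omega, fun i j h1 h2 => by omega⟩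
  have hvb : b ∈ visiblePoints e a b := ⟨by omega, le_rfl, fun i j h1 h2 => by omega⟩
  obtain ⟨c, hvc, hac, hcb, -⟩ := exists_mem_visiblePoints hcross hunit h2
  have hc : sbtw (vertex u a) (vertex u c) (vertex u b) :=
    (sbtw_vertex_of_le (by omega) hb ham (by omega)).2 ⟨hac, hcb⟩
  refine ⟨?_, ?_, ?_⟩
  · have hsub : ({vertex u a, vertex u c, vertex u b} : Set (ZMod m)) ⊆
        vertex u '' visiblePoints e a b := by
      rintro _ (rfl | rfl | rfl)
      exacts [⟨a, hva, rfl⟩, ⟨c, hvc, rfl⟩, ⟨b, hvb, rfl⟩]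
    refine le_trans (le_of_eq ?_) (Set.ncard_le_ncard hsub (Set.toFinite _))
    rw [Set.ncard_insert_of_notMem, Set.ncard_pair]
    · exact fun e => sbtw_irrefl_right (e ▸ hc)
    · rintro (e | e)
      · exact sbtw_irrefl_left (e ▸ hc)
      · exact sbtw_irrefl_left_right (e ▸ hc)
  · rintro _ ⟨_, ⟨i, hi, rfl⟩, _, ⟨j, hj, rfl⟩, hij, hs, rfl⟩
    have hib := hi.2.1
    have hjb := hj.2.1
    have hia := hi.1
    have hja := hj.1
    rcases lt_trichotomy i j with h | rfl | h
    · refine rel_of_visiblePoints hcross hunit hab hi hj h fun z hz hz' => ?_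
      have := hz.2.1
      exact hs _ ⟨z, hz, rfl⟩ ((sbtw_vertex_of_le h (by omega) (by omega) (by omega)).2 hz')
    · exact absurd rfl hij
    -- A side running against the labels can only be the closing side from `b` to `a`.
    · have e1 := hs _ ⟨b, hvb, rfl⟩
      have e2 := hs _ ⟨a, hva, rfl⟩
      obtain rfl : i = b := by
        by_contra hne
        exact e1 ((sbtw_vertex_of_le (by omega) hb (by omega) (by omega)).2
          (⟨h, by omega⟩ : j < i ∧ i < b)).cyclic_left
      obtain rfl : j = a := by
        by_contra hne
        exact e2 ((sbtw_vertex_of_le (by omega) hb (by omega) (by omega)).2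
          (⟨by omega, h⟩ : a < j ∧ j < i)).cyclic_right
      rwa [Sym2.eq_swap]
  · rw [Set.disjoint_left]
    have key : ∀ i ∈ visiblePoints e a b, ∀ j ∈ visiblePoints e a b, i < j →
        s(vertex u i, vertex u j) ∈ D →
        s(vertex u i, vertex u j) ∈ polygonSides (vertex u '' visiblePoints e a b) := by
      intro i hi j hj hij hijD
      have hib := hi.2.1
      have hjb := hj.2.1
      have hia := hi.1
      have hne : vertex u i ≠ vertex u j := by
        intro h
        have := eq_or_of_vertex_eq (by omega) (by omega) h
        omega
      rw [mem_polygonSides]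
      -- A diagonal over a visible point is `(a, b)`, the closing side; otherwise its endpoints are
      -- consecutive.
      by_cases hz : ∃ z ∈ visiblePoints e a b, i < z ∧ z < j
      · obtain ⟨z, hz, hiz, hzj⟩ := hz
        obtain ⟨rfl, rfl⟩ := hz.2.2 i j hia hiz hzj hjb (Or.inr hijD)
        refine Or.inr ⟨⟨_, hj, rfl⟩, ⟨_, hi, rfl⟩, hne.symm, ?_⟩
        rintro _ ⟨w, hw, rfl⟩ hs
        have h1 := hw.1
        have h2 := hw.2.1
        have := lt_or_lt_of_sbtw_vertex hij hb ham (by omega) hs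
        omega
      · push Not at hz
        refine Or.inl ⟨⟨_, hi, rfl⟩, ⟨_, hj, rfl⟩, hne, ?_⟩
        rintro _ ⟨w, hw, rfl⟩ hs
        have h2 := hw.2.1
        rw [sbtw_vertex_of_le hij (by omega) (by omega) (by omega)] at hs
        have := hz w hw hs.1
        omega
    rintro _ ⟨_, ⟨i, hi, rfl⟩, _, ⟨j, hj, rfl⟩, hij, rfl, hs⟩ hmem
    rcases lt_trichotomy i j with h | rfl | h
    · exact hs (key i hi j hj h hmem)
    · exact hij rfl
    · rw [Sym2.eq_swap] at hs hmem
      exact hs (key j hj i hi h hmem)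

/-- The piece just below the arc consists of its visible points. Being a triangle, it has exactly
one vertex strictly inside, which is the apex. -/
theorem IsDissection.exists_apex (hD : IsDissection D) (hb : b ≤ m) (ham : b < a + m)
    (h2 : a + 2 ≤ b) (hab : s(vertex u a, vertex u b) ∈ polygonSides Set.univ ∪ D)
    (htri : ∀ Q, IsPiece D Q → (∃ c, a < c ∧ c < b ∧ vertex u c ∈ Q) → Q.ncard = 3) :
    ∃ c, a < c ∧ c < b ∧ s(vertex u a, vertex u c) ∈ polygonSides Set.univ ∪ D ∧
      s(vertex u c, vertex u b) ∈ polygonSides Set.univ ∪ D := by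
  have hQ := hD.isPiece_visiblePoints hb ham h2 hab
  set e : ℕ → ℕ → Prop := fun i j => s(vertex u i, vertex u j) ∈ polygonSides Set.univ ∪ D with he
  have hcross : ∀ i k j l, a ≤ i → i < k → k < j → j < l → l ≤ b → e i j → e k l → False :=
    fun i k j l h1 h2 h3 h4 h5 h6 h7 => hD.not_crossing hb ham h1 h2 h3 h4 h5 h6 h7
  have hunit : ∀ i, a ≤ i → i < b → e i (i + 1) := fun i h1 h2 =>
    Or.inl (mem_polygonSides.2 (Or.inl (isSide_univ_vertex_succ (by omega) (by omega))))
  have hva : a ∈ visiblePoints e a b := ⟨le_rfl, by omega, fun i j h1 h2 => by omega⟩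
  have hvb : b ∈ visiblePoints e a b := ⟨by omega, le_rfl, fun i j h1 h2 => by omega⟩
  obtain ⟨c, hvc, hac, hcb, hec⟩ := exists_mem_visiblePoints hcross hunit h2
  refine ⟨c, hac, hcb, hec, rel_of_visiblePoints hcross hunit hab hvc hvb hcb ?_⟩
  intro z hz hzc
  have hcard := htri _ hQ ⟨c, hac, hcb, c, hvc, rfl⟩
  have hinj : Set.InjOn (vertex u) ({a, c, z, b} : Set ℕ) := by
    have hle : ∀ x ∈ ({a, c, z, b} : Set ℕ), a ≤ x ∧ x ≤ b := by
      rintro x (rfl | rfl | rfl | rfl) <;> omega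
    intro x hx y hy hxy
    have h1 := hle x hx
    have h2 := hle y hy
    have := eq_or_of_vertex_eq (by omega) (by omega) hxy
    omega
  have hsub : vertex u '' ({a, c, z, b} : Set ℕ) ⊆ vertex u '' visiblePoints e a b := by
    apply Set.image_mono
    rintro x (rfl | rfl | rfl | rfl) <;> assumption
  have h4 := Set.ncard_le_ncard hsub (Set.toFinite _)
  rw [hcard, hinj.ncard_image, Set.ncard_insert_of_notMem (by simp; omega),
    Set.ncard_insert_of_notMem (by simp; omega), Set.ncard_pair (by omega)] at h4
  omega

/-- Each diagonal of the dissection lies beyond a side of a given piece. -/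
theorem IsPiece.exists_isSide_of_mem (hD : IsDissection D) {P : Set (ZMod m)} (hP : IsPiece D P)
    {w z : ZMod m} (h : s(w, z) ∈ D) :
    ∃ x y, IsSide P x y ∧ ¬ sbtw y w x ∧ ¬ sbtw y z x := by
  have key : ∀ w z, s(w, z) ∈ D → w ∉ P → ∃ x y, IsSide P x y ∧ ¬ sbtw y w x ∧ ¬ sbtw y z x := by
    intro w z h hw
    obtain ⟨x, hx, -⟩ := exists_ne_of_three_le hP.1 w w
    obtain ⟨y, hy, hxy, -⟩ := exists_ne_of_three_le hP.1 x w
    obtain ⟨u, v, hs, hws⟩ := exists_isSide_sbtw hx hy hxy.symm hw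
    exact ⟨u, v, hs, fun h' => sbtw_asymm h' hws,
      fun h' => hD.not_sbtw (hP.mem_edges hs) (Or.inr h) hws h'⟩
  by_cases hw : w ∈ P
  · by_cases hz : z ∈ P
    · have hwz : w ≠ z := by
        obtain ⟨x, -, y, -, hxy, he, -⟩ := hD.1 h
        rintro rfl
        rcases Sym2.eq_iff.1 he with ⟨rfl, rfl⟩ | ⟨rfl, rfl⟩ <;> exact hxy rfl
      rcases hP.isSide_or_isSide hw hz hwz (Or.inr h) with hs | hs
      · exact ⟨w, z, hs, sbtw_irrefl_right, sbtw_irrefl_left⟩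
      · exact ⟨z, w, hs, sbtw_irrefl_left, sbtw_irrefl_right⟩
    · obtain ⟨x, y, h1, h2, h3⟩ := key z w (Sym2.eq_swap ▸ h) hz
      exact ⟨x, y, h1, h3, h2⟩
  · exact key w z h hw

theorem exists_vertex_of_not_sbtw (hab : a < b) (hb : b ≤ m) (ham : b < a + m) {w : ZMod m}
    (hw : ¬ sbtw (vertex u b) w (vertex u a)) : ∃ i, a ≤ i ∧ i ≤ b ∧ w = vertex u i := by
  have h0 : 0 < m := Nat.pos_of_neZero m
  obtain ⟨i, hi, rfl⟩ := exists_vertex_eq u w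
  rcases hb.lt_or_eq with hb | rfl
  · rw [sbtw_vertex_iff hb hi (by omega)] at hw
    exact ⟨i, by omega, by omega, rfl⟩
  · rw [vertex_self_eq, sbtw_vertex_iff h0 hi (by omega)] at hw
    by_cases hi0 : i = 0
    · exact ⟨b, hab.le, le_rfl, by rw [hi0, vertex_self_eq]⟩
    · exact ⟨i, by omega, by omega, rfl⟩

theorem exists_vertex_of_isSide {P : Set (ZMod m)} {x y : ZMod m} (hu : u ∈ P)
    (hs : IsSide P x y) : ∃ a b, a < b ∧ b ≤ m ∧ x = vertex u a ∧ y = vertex u b := by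
  have h0 : 0 < m := Nat.pos_of_neZero m
  obtain ⟨a, ha, rfl⟩ := exists_vertex_eq u x
  obtain ⟨b, hb, rfl⟩ := exists_vertex_eq u y
  by_cases hb0 : b = 0
  · exact ⟨a, m, ha, le_rfl, rfl, by rw [hb0, vertex_self_eq]⟩
  · refine ⟨a, b, ?_, hb.le, rfl, rfl⟩
    have h1 := hs.2.2.1
    have h2 := hs.2.2.2 (vertex u 0) (by rwa [vertex_zero])
    rw [ne_eq, vertex_inj ha hb] at h1
    rw [sbtw_vertex_iff ha h0 hb] at h2
    omega

/-- Surjectivity: cut the polygon open at `u`, take the labels of the center as boundary points, and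
take as arcs all edges that do not pass over one. -/
theorem MarkedDissection.exists_isBinaryForest {r : ℕ} (hr : 3 ≤ r) (x : MarkedDissection r m)
    {u v : ZMod m} (hs : IsSide x.center u v) (he : x.edge = s(u, v)) :
    ∃ (L : List ℕ) (E : Set (ℕ × ℕ)) (h : IsBinaryForest 0 m L E) (hL : L.length = r),
      h.markedDissection hr hL u = x := by
  classical
  have h0 : 0 < m := Nat.pos_of_neZero m
  have hcard : 3 ≤ x.center.ncard := by rw [x.ncard_center]; exact hr
  -- Labels run from `1` to `m`, so `u` is recorded as `m`; the label `0` is prepended in `0 :: L`.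
  let S : Finset ℕ := (Finset.Icc 1 m).filter fun p => vertex u p ∈ x.center
  have hS : ∀ p, p ∈ S ↔ (1 ≤ p ∧ p ≤ m) ∧ vertex u p ∈ x.center := by simp [S]
  obtain ⟨p, q, hp0, hpq, hqm, hp, hq⟩ : ∃ p q, 0 < p ∧ p < q ∧ q < m ∧ p ∈ S ∧ q ∈ S := by
    obtain ⟨y, hy, hyu, -⟩ := exists_ne_of_three_le hcard u u
    obtain ⟨z, hz, hzu, hzy⟩ := exists_ne_of_three_le hcard u y
    obtain ⟨i, hi, rfl⟩ := exists_vertex_eq u y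
    obtain ⟨j, hj, rfl⟩ := exists_vertex_eq u z
    have hi0 : i ≠ 0 := by rintro rfl; exact hyu (vertex_zero u)
    have hj0 : j ≠ 0 := by rintro rfl; exact hzu (vertex_zero u)
    have hij : i ≠ j := by rintro rfl; exact hzy rfl
    have hiS : i ∈ S := (hS i).2 ⟨by omega, hy⟩
    have hjS : j ∈ S := (hS j).2 ⟨by omega, hz⟩
    rcases Nat.lt_or_gt_of_ne hij with h | h
    · exact ⟨i, j, by omega, h, hj, hiS, hjS⟩
    · exact ⟨j, i, by omega, h, hi, hjS, hiS⟩
  have hmS : m ∈ S := (hS m).2 ⟨by omega, by rw [vertex_self]; exact hs.1⟩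
  let L : List ℕ := S.sort (· ≤ ·)
  have hLS : ∀ p, p ∈ L ↔ p ∈ S := fun p => Finset.mem_sort _
  let E : Set (ℕ × ℕ) := {e | e.1 < e.2 ∧ e.2 ≤ m ∧ (∀ p ∈ L, ¬ (e.1 < p ∧ p < e.2)) ∧
    s(vertex u e.1, vertex u e.2) ∈ polygonSides Set.univ ∪ x.diagonals}
  have hlen : ∀ {a b}, a < b → b ≤ m → (∀ p ∈ L, ¬ (a < p ∧ p < b)) → b + 2 ≤ a + m := by
    intro a b h1 h2 h3
    have := h3 p ((hLS p).2 hp)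
    have := h3 q ((hLS q).2 hq)
    omega
  have hsort : (0 :: L).Pairwise (· < ·) := List.pairwise_cons.2
    ⟨fun p hp => ((hS p).1 ((hLS p).1 hp)).1.1, S.sortedLT_sort.pairwise⟩
  have hmem : ∀ a ∈ 0 :: L, vertex u a ∈ x.center := by
    intro a ha
    rcases List.mem_cons.1 ha with rfl | ha
    · rw [vertex_zero]; exact hs.1
    · exact ((hS a).1 ((hLS a).1 ha)).2
  have hle : ∀ a ∈ 0 :: L, a ≤ m := by
    intro a ha
    rcases List.mem_cons.1 ha with rfl | ha
    · omega
    · exact ((hS a).1 ((hLS a).1 ha)).1.2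
  have h : IsBinaryForest 0 m L E := by
    refine ⟨hsort, ?_, ?_, fun p hp => hle p (List.mem_cons_of_mem _ hp), ?_, ?_, ?_⟩
    · rw [List.isChain_iff_forall_rel_of_append_cons_cons]
      intro a b l₁ l₂ hl
      rw [hl] at hsort
      simp only [List.pairwise_append, List.pairwise_cons, List.mem_cons, forall_eq_or_imp]
        at hsort
      have hab : a < b := hsort.2.1.1.1
      have hb : b ≤ m := hle b (by rw [hl]; simp)
      have hno : ∀ p ∈ L, ¬ (a < p ∧ p < b) := by
        intro p hp hpab
        have hp' : p ∈ 0 :: L := List.mem_cons_of_mem _ hp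
        rw [hl, List.mem_append, List.mem_cons, List.mem_cons] at hp'
        rcases hp' with hp' | hp' | hp' | hp'
        · have := (hsort.2.2 p hp').1; omega
        · omega
        · omega
        · have := hsort.2.1.2.1 p hp'; omega
      have h5 := hlen hab hb hno
      refine ⟨hab, hb, hno, x.isPiece_center.mem_edges ⟨hmem a (by rw [hl]; simp),
        hmem b (by rw [hl]; simp), ?_, ?_⟩⟩
      · intro h
        have := eq_or_of_vertex_eq (by omega) (by omega) h
        omega
      · intro c hc hcs
        obtain ⟨k, hk, rfl⟩ := exists_vertex_eq u c
        rw [sbtw_vertex_of_le hab hb (by omega) hk.le] at hcs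
        exact hno k ((hLS k).2 ((hS k).2 ⟨by omega, hc⟩)) hcs
    · exact List.mem_cons_of_mem _ ((hLS m).2 hmS)
    · rintro a b ⟨h1, h2, h3, -⟩
      exact ⟨Nat.zero_le _, h1, h2, h3⟩
    · rintro a b c d ⟨h1, h2, h3, h4⟩ ⟨h5, h6, h7, h8⟩ hac hcb hbd
      simp only at *
      have g1 := hlen h1 h2 h3
      have g2 := hlen h5 h6 h7
      have e1 := h3 p ((hLS p).2 hp)
      have e2 := h3 q ((hLS q).2 hq)
      have e3 := h7 p ((hLS p).2 hp)
      have e4 := h7 q ((hLS q).2 hq)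
      exact x.isDissection.not_crossing h6 (by omega) le_rfl hac hcb hbd le_rfl h4 h8
    · rintro a b ⟨h1, h2, h3, h4⟩ hab
      simp only at *
      have g1 := hlen h1 h2 h3
      -- No vertex of the center lies strictly inside the arc, so every piece with a vertex there is
      -- a triangle.
      obtain ⟨c, hac, hcb, h5, h6⟩ := x.isDissection.exists_apex h2 (by omega) hab h4 (by
        rintro Q hQ ⟨c, hac, hcb, hcQ⟩
        refine x.ncard_of_ne Q hQ ?_
        rintro rfl
        exact h3 c ((hLS c).2 ((hS c).2 ⟨by omega, hcQ⟩)) ⟨hac, hcb⟩)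
      refine ⟨c, hac, hcb, ⟨hac, by simp only; omega, fun p hp hp' => ?_, h5⟩,
        ⟨hcb, h2, fun p hp hp' => ?_, h6⟩⟩
      · simp only at hp'
        exact h3 p hp (by omega)
      · simp only at hp'
        exact h3 p hp (by omega)
  have hcenter : forestCenter u L = x.center := by
    ext w
    constructor
    · rintro ⟨a, ha, rfl⟩
      exact hmem a (List.mem_cons_of_mem _ ha)
    · intro hw
      obtain ⟨i, hi, rfl⟩ := exists_vertex_eq u w
      by_cases hi0 : i = 0
      · rw [hi0, ← vertex_self_eq]
        exact ⟨m, (hLS m).2 hmS, rfl⟩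
      · exact ⟨i, (hLS i).2 ((hS i).2 ⟨by omega, hw⟩), rfl⟩
  have hL : L.length = r := by
    rw [← h.ncard_forestCenter (u := u), hcenter, x.ncard_center]
  have hdiag : forestDiagonals u E = x.diagonals := by
    ext e
    constructor
    · intro hmem
      have hns := (h.isDissection (u := u) (by omega)).1 hmem
      obtain ⟨a, b, hab, h2, rfl⟩ := hmem
      rcases hab.2.2.2 with hside | hD
      · obtain ⟨-, -, -, -, -, -, hns⟩ := hns
        exact absurd hside hns
      · exact hD
    · induction e using Sym2.ind with
      | _ w z =>
      intro hD
      have hns : s(w, z) ∉ polygonSides Set.univ := by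
        obtain ⟨-, -, -, -, -, -, hns⟩ := x.isDissection.1 hD
        exact hns
      -- The diagonal lies beyond a side of the center, which confines its labels to the interval of
      -- one root, so it passes over no boundary point.
      obtain ⟨y, y', hy, hw, hz⟩ := x.isPiece_center.exists_isSide_of_mem x.isDissection hD
      obtain ⟨a, b, hab, hb, rfl, rfl⟩ := exists_vertex_of_isSide hs.1 hy
      rw [← hcenter] at hy
      obtain ⟨a', b', hab', ha', hb'⟩ := h.exists_of_isSide hy
      have hno : b + 2 ≤ a + m ∧ ∀ p ∈ L, ¬ (a < p ∧ p < b) := by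
        obtain ⟨h1, h2, h3, -⟩ := hab'
        simp only at *
        have h4 := hlen h1 h2 h3
        have h5 := eq_or_of_vertex_eq (by omega) (by omega) ha'
        have h6 := eq_or_of_vertex_eq (by omega) (by omega) hb'
        obtain rfl : a = a' := by omega
        obtain rfl : b = b' := by omega
        exact ⟨h4, h3⟩
      obtain ⟨i, hai, hib, rfl⟩ := exists_vertex_of_not_sbtw hab hb (by omega) hw
      obtain ⟨j, haj, hjb, rfl⟩ := exists_vertex_of_not_sbtw hab hb (by omega) hz
      have key : ∀ i j, a ≤ i → j ≤ b → i < j → s(vertex u i, vertex u j) ∈ x.diagonals →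
          s(vertex u i, vertex u j) ∉ polygonSides Set.univ →
          s(vertex u i, vertex u j) ∈ forestDiagonals u E := by
        intro i j hi hj hij hD hns
        refine ⟨i, j, ⟨hij, by simp only; omega, fun p hp hp' => ?_, Or.inr hD⟩, ?_, rfl⟩
        · simp only at hp'
          exact hno.2 p hp (by omega)
        · by_contra hlt
          obtain rfl : j = i + 1 := by omega
          exact hns (mem_polygonSides.2 (Or.inl
            (isSide_univ_vertex_succ (by omega) (by omega))))
      rcases lt_trichotomy i j with hij | rfl | hij
      · exact key i j hai hjb hij hD hns
      · obtain ⟨c, -, d, -, hcd, he, -⟩ := x.isDissection.1 hD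
        rcases Sym2.eq_iff.1 he with ⟨rfl, rfl⟩ | ⟨rfl, rfl⟩ <;> exact absurd rfl hcd
      · rw [Sym2.eq_swap] at hD hns ⊢
        exact key j i haj hib hij hD hns
  have hedge : s(vertex u 0, vertex u (L.headD 0)) = x.edge := by
    have h1 := h.isSide_edge (u := u) (by omega)
    rw [hcenter, vertex_zero] at h1
    rw [vertex_zero, he, IsSide.right_unique h1 hs]
  refine ⟨L, E, h, hL, ?_⟩
  obtain ⟨D, _, C, _, _, _, e, _⟩ := x
  simp only [IsBinaryForest.markedDissection, MarkedDissection.mk.injEq]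
  exact ⟨hdiag, hcenter, hedge⟩

end

/-! ### Marked dissections up to rotation as binary forests, and the comparison of counts -/

theorem nonempty_equiv_markedDissectionUpToRotation {r m : ℕ} [NeZero m] (hr : 3 ≤ r) :
    Nonempty (binaryForests 0 m r ≃ MarkedDissectionUpToRotation r m) := by
  refine ⟨Equiv.ofBijective
    (fun G => Quotient.mk (MarkedDissection.rotationSetoid r m)
      (G.2.1.markedDissection hr G.2.2 0)) ⟨?_, ?_⟩⟩
  · rintro ⟨⟨L, E⟩, h, hL⟩ ⟨⟨L', E'⟩, h', hL'⟩ hG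
    obtain ⟨rfl, rfl⟩ := h.eq_of_rotated h' hr hL hL' (Quotient.exact hG)
    rfl
  · intro x
    induction x using Quotient.ind with
    | _ x =>
    obtain ⟨u, v, hs, he⟩ : ∃ u v, IsSide x.center u v ∧ x.edge = s(u, v) := by
      obtain ⟨u, hu, v, hv, huv, hs, he⟩ := x.edge_mem
      exact ⟨u, v, ⟨hu, hv, huv, hs⟩, he⟩
    -- The forest is read off from base vertex `u`; rotation by `u` carries the dissection based at
    -- `0` to this one.
    obtain ⟨L, E, h, hL, rfl⟩ := x.exists_isBinaryForest hr hs he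
    refine ⟨⟨(L, E), h, hL⟩, Quotient.sound ⟨u, ?_, ?_, ?_⟩⟩
    · change forestDiagonals u E = Sym2.map (fun v => v + u) '' forestDiagonals 0 E
      rw [image_forestDiagonals, zero_add]
    · change forestCenter u L = (fun v => v + u) '' forestCenter 0 L
      rw [image_forestCenter, zero_add]
    · change s(vertex u 0, vertex u (L.headD 0)) =
        Sym2.map (fun v => v + u) s(vertex 0 0, vertex 0 (L.headD 0))
      simp [vertex, add_comm]

theorem theorem6p3 (n k : ℕ) (hk : 1 ≤ k) :
    Nonempty (DescStrictlyNaples k n ≃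
      MarkedDissectionUpToRotation (2 * k + 2) (n + k + 1)) := by
  obtain ⟨e⟩ := nonempty_equiv_markedDissectionUpToRotation (r := 2 * k + 2) (m := n + k + 1) (by omega)
  obtain ⟨hfin, hcard⟩ := card_descStrictlyNaples k n hk
  suffices h : (binaryForests 0 (n + k + 1) (2 * k + 2)).Finite ∧
      (binaryForests 0 (n + k + 1) (2 * k + 2)).ncard = Nat.card (DescStrictlyNaples k n) by
    have : Finite (binaryForests 0 (n + k + 1) (2 * k + 2)) := h.1
    obtain ⟨f⟩ := Finite.card_eq.1 h.2.symm
    exact ⟨f.trans e⟩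
  by_cases hnk : n ≤ k
  · rw [binaryForests_eq_empty (by omega)]
    rw [Nat.choose_eq_zero_of_lt (by omega : 2 * n - 1 < n + k)] at hcard
    refine ⟨Set.finite_empty, ?_⟩
    rw [Set.ncard_empty]
    omega
  -- Here `s` is the number of triangles, that is, of inner nodes.
  · obtain ⟨s, rfl⟩ : ∃ s, n = k + 1 + s := ⟨n - (k + 1), by omega⟩
    have h1 := ncard_binaryForests s (2 * k + 2) 0
    rw [show 0 + (2 * k + 2) + s = k + 1 + s + k + 1 by omega] at h1
    refine ⟨h1.1, ?_⟩
    have h2 := numForests_add_choose s (2 * k + 2) (by omega)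
    rw [show 2 * (k + 1 + s) - 1 = 2 * s + (2 * k + 2) - 1 by omega,
      show k + 1 + s + k + 1 = s + (2 * k + 2) by omega] at hcard
    have h3 : (2 * s + (2 * k + 2) - 1).choose (k + 1 + s + k) =
        (2 * s + (2 * k + 2) - 1).choose s := by
      rw [show 2 * s + (2 * k + 2) - 1 = k + 1 + s + k + s by omega]
      exact Nat.choose_symm_add
    rw [h1.2]
    omega
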